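/- **Setting.** A *modal bi-Heyting algebra* $\mathbf A$ is a bi-Heyting algebra (with $u\wedge v\le w$ iff $u\le v\to w$, and $u-v\le w$ iff $u\le v\vee w$) with operations $\Box$ and $\Diamond$ preserving finite meets and finite joins, respectively. Its canonical extension $\mathbf A^\delta$ is the completely distributive complete lattice extending $\mathbf A$ in which $\mathbf A$ is dense (every element is a join of meets and a meet of joins of elements of $A$) and compact ($\bigwedge S\le\bigvee T$ with $S,T\subseteq A$ implies $\bigwedge S'\le\bigvee T'$ for some finite $S'\subseteq S$, $T'\subseteq T$); it carries the residuals $\to$ and $-$, the extensions $\Diamond^\sigma$ and $\Box^\pi$, the right adjoint $\blacksquare$ of $\Diamond$ and the left adjoint $\blacklozenge$ of $\Box$. $J^\infty(\mathbf A^\delta)$ and $M^\infty(\mathbf A^\delta)$ are the sets of completely join-, resp. meet-irreducible elements. $\mathcal L_1$ (resp. $\mathcal L_2$) is the language of modal bi-Heyting algebras with fixed point binders $\mu X.t,\nu X.t$ (resp. $\mu_2X.t,\nu_2X.t$), for $t$ positive in $X$. In $\mathbf A$, $\mu X.t(X)=\bigwedge\{a\in A\mid t(a)\le a\}$, while $\mu_2X.t(X)=\bigvee_\alpha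 t^\alpha(\bot)$ is the join of the transfinite approximants, if these meets and joins exist; $\nu$ and $\nu_2$ are defined dually. $\mathbf A$ is a *mu-algebra of the first kind* (*second kind*) if all $\mathcal L_1$-terms ($\mathcal L_2$-terms) are everywhere defined on $\mathbf A$. $\mathcal L_*$ has instead binders $\mu^*,\nu^*$, and $\mathcal L^+_*$ has in addition $\blacksquare$, $\blacklozenge$, nominals and co-nominals. They are interpreted in $\mathbf A^\delta$, with $\mu^*X.t(X)=\bigwedge\{a\in A\mid t(a)\le a\}$ and $\nu^*X.t(X)=\bigvee\{a\in A\mid a\le t(a)\}$. $\varphi^*$ is $\varphi$ with $\mu,\nu$ replaced by $\mu^*,\nu^*$. An *admissible assignment* sends propositional variables into $A$, nominals into $J^\infty(\mathbf A^\delta)$ and co-nominals into $M^\infty(\mathbf A^\delta)$. An inequality or quasi-inequality $\varphi_1\le\psi_1\,\&\cdots\&\,\varphi_k\le\psi_k\Rightarrow\varphi\le\psi$ between sentences is *admissibly valid* on $\mathbf A^\delta$ if it is true under all admissible assignments. *Syntactically open* formulas $\varphi$ and *syntactically closed* formulas $\psi$ of $\mathcal L^+_*$ are given by $$\varphi::=\bot\mid\top\mid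 p\mid X\mid\mathbf m\mid\varphi\wedge\varphi\mid\varphi\vee\varphi\mid\psi\to\varphi\mid\varphi-\psi\mid\Box\varphi\mid\Diamond\varphi\mid\blacksquare\varphi\mid\nu^*X.\varphi,$$ $$\psi::=\bot\mid\top\mid p\mid X\mid\mathbf i\mid\psi\wedge\psi\mid\psi\vee\psi\mid\varphi\to\psi\mid\psi-\varphi\mid\Box\psi\mid\Diamond\psi\mid\blacklozenge\psi\mid\mu^*X.\psi.$$ **Rules.** The *$\mu^*$-ALBA rules* replace inequalities in the antecedent of a quasi-inequality (a conjunction, taken up to associativity, commutativity and idempotence of $\&$) as follows; nominals and co-nominals on the right that are not on the left must be fresh. * Residuation: $\chi-\psi\le\varphi\leadsto\chi\le\psi\vee\varphi$; $\ \varphi\le\chi\to\psi\leadsto\varphi\wedge\chi\le\psi$; $\ \chi\wedge\psi\le\varphi\leadsto\chi\le\psi\to\varphi$ or $\psi\le\chi\to\varphi$; $\ \varphi\le\chi\vee\psi\leadsto\varphi-\chi\le\psi$ or $\varphi-\psi\le\chi$. * Adjunction: $\varphi\vee\chi\le\psi\leadsto\varphi\le\psi\,\&\,\chi\le\psi$;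 $\ \psi\le\varphi\wedge\chi\leadsto\psi\le\varphi\,\&\,\psi\le\chi$; $\ \Diamond\varphi\le\psi\leadsto\varphi\le\blacksquare\psi$; $\ \varphi\le\Box\psi\leadsto\blacklozenge\varphi\le\psi$. * Approximation: $\Box\psi\le\mathbf m\leadsto\Box\mathbf n\le\mathbf m\,\&\,\psi\le\mathbf n$; $\ \mathbf j\le\Diamond\psi\leadsto\mathbf j\le\Diamond\mathbf i\,\&\,\mathbf i\le\psi$; $\ \chi\to\varphi\le\mathbf m\leadsto\mathbf j\to\mathbf n\le\mathbf m\,\&\,\mathbf j\le\chi\,\&\,\varphi\le\mathbf n$; $\ \mathbf i\le\chi-\varphi\leadsto\mathbf i\le\mathbf j-\mathbf n\,\&\,\mathbf j\le\chi\,\&\,\varphi\le\mathbf n$. * Right Ackermann rule: if $p$ does not occur in the rest of the quasi-inequality, all $\alpha_i$ are $p$-free and syntactically closed, all $\beta_j$ are positive in $p$ and syntactically closed, and all $\gamma_j$ are negative in $p$ and syntactically open, then $\&_i\,\alpha_i\le p\ \&\ \&_j\,\beta_j(p)\le\gamma_j(p)$ is replaced by $\&_j\,\beta_j(\bigvee_i\alpha_i/p)\le\gamma_j(\bigvee_i\alpha_i/p)$.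 * Left Ackermann rule: if $p$ does not occur in the rest of the quasi-inequality, all $\alpha_i$ are $p$-free and syntactically open, all $\beta_j$ are positive in $p$ and syntactically open, and all $\gamma_j$ are negative in $p$ and syntactically closed, then $\&_i\,p\le\alpha_i\ \&\ \&_j\,\gamma_j(p)\le\beta_j(p)$ is replaced by $\&_j\,\gamma_j(\bigwedge_i\alpha_i/p)\le\beta_j(\bigwedge_i\alpha_i/p)$. * Fixed point approximation rules. Let $\tau\in\{1,\partial\}^n$, let $\psi(\overline x,X)$ be an $\mathcal L_*$-formula positive in $X$, without propositional variables and with free variables among $\overline x,X$, whose term function on $\mathbf A^\delta$ preserves all joins as a map $(\mathbf A^\delta)^\tau\times\mathbf A^\delta\to\mathbf A^\delta$, and let $\overline\varphi$ be an $n$-tuple of $\mathcal L_*$-sentences. A quasi-inequality with the inequality $\mathbf i\le\mu^*X.\psi(\overline\varphi/\overline x,X)$ in its antecedent is replaced by $n$ quasi-inequalities: in the $k$-th of them, that inequality is replaced by $\mathbf i\le\mu^*X.\psi(\overline{\mathbf j}_k/\overline x,X)\ \&\ \mathbf j^{\tau_k}\le^{\tau_k}\varphi_k$, where $\mathbf j^{\tau_k}$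 is a fresh nominal if $\tau_k=1$ and a fresh co-nominal if $\tau_k=\partial$, the relation $\le^1$ is $\le$ and $\le^\partial$ is $\ge$, and $\overline{\mathbf j}_k$ has $\mathbf j^{\tau_k}$ in coordinate $k$ and, in every coordinate $l\ne k$, $\bot$ if $\tau_l=1$ and $\top$ if $\tau_l=\partial$. Dually for an inequality $\nu^*X.\varphi(\overline\psi/\overline x,X)\le\mathbf m$, with the term function of $\varphi$ preserving all meets. **Statement.** Let $\varphi\le\psi$ be an inequality between $\mathcal L_1$-sentences, let $\mathbf i$ be a nominal and $\mathbf m$ a co-nominal, and let $\mathsf{FA}(\varphi^*\le\psi^*)$ be the quasi-inequality $\mathbf i\le\varphi^*\ \&\ \psi^*\le\mathbf m\Rightarrow\mathbf i\le\mathbf m$. 1. If $\mathbf A$ is a mu-algebra of the second kind, and a set $\mathcal Q$ of quasi-inequalities is obtained from $\{\mathsf{FA}(\varphi^*\le\psi^*)\}$ by finitely many applications of $\mu^*$-ALBA rules to members of the set, then $\varphi^*\le\psi^*$ is admissibly valid on $\mathbf A^\delta$ if and only if every member of $\mathcal Q$ is admissibly valid on $\mathbf A^\delta$. 2. If $\mathbf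 A$ is a mu-algebra of the first kind, and a quasi-inequality $\mathsf Q$ is obtained from $\mathsf{FA}(\varphi^*\le\psi^*)$ by finitely many applications of $\mu^*$-ALBA rules other than the fixed point approximation rules, then $\varphi^*\le\psi^*$ is admissibly valid on $\mathbf A^\delta$ if and only if $\mathsf Q$ is. -/

import Mathlib

universe u v

namespace MuALBA

/-! ## Algebras -/

/-- Modal bi-Heyting algebras. In Mathlib's notation the implication is `a ⇨ b` and the
subtraction is `a \ b`, with `a \ b ≤ c ↔ a ≤ b ⊔ c`. -/
class ModalBiheytingAlgebra (A : Type u) extends BiheytingAlgebra A where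
  box : A → A
  dia : A → A
  box_top : box ⊤ = ⊤
  box_inf : ∀ a b, box (a ⊓ b) = box a ⊓ box b
  dia_bot : dia ⊥ = ⊥
  dia_sup : ∀ a b, dia (a ⊔ b) = dia a ⊔ dia b

/-- Completely join-irreducible elements of a complete lattice. -/
def IsCJI {C : Type v} [CompleteLattice C] (j : C) : Prop :=
  ∀ S : Set C, j = sSup S → ∃ x ∈ S, j = x

/-- Completely meet-irreducible elements of a complete lattice. -/
def IsCMI {C : Type v} [CompleteLattice C] (m : C) : Prop :=
  ∀ S : Set C, m = sInf S → ∃ x ∈ S, m = x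

section CanonicalExtension

variable {A : Type u} [ModalBiheytingAlgebra A] {C : Type v} [CompletelyDistribLattice C]

/-- Closed elements: meets of elements of `A`. -/
def IsClosedElem (e : BoundedLatticeHom A C) (c : C) : Prop :=
  ∃ S : Set A, c = sInf (e '' S)

/-- Open elements: joins of elements of `A`. -/
def IsOpenElem (e : BoundedLatticeHom A C) (c : C) : Prop :=
  ∃ S : Set A, c = sSup (e '' S)

/-- The bounded lattice homomorphism `e : A → C` exhibits `C` as the canonical extension of `A`:
it is an embedding into a complete lattice in which the image of `A` is dense and compact. -/
structure IsCanonicalExtension (e : BoundedLatticeHom A C) : Prop where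
  injective : Function.Injective e
  dense_join : ∀ c : C, ∃ K : Set C, (∀ k ∈ K, IsClosedElem e k) ∧ c = sSup K
  dense_meet : ∀ c : C, ∃ U : Set C, (∀ w ∈ U, IsOpenElem e w) ∧ c = sInf U
  compact : ∀ S T : Set A, sInf (e '' S) ≤ sSup (e '' T) →
    ∃ S' T' : Finset A, (S' : Set A) ⊆ S ∧ (T' : Set A) ⊆ T ∧ S'.inf id ≤ T'.sup id

/-- The `σ`-extension of a map `f : A → A`. -/
def sigmaExt (e : BoundedLatticeHom A C) (f : A → A) (c : C) : C :=
  sSup {x | ∃ k w, IsClosedElem e k ∧ IsOpenElem e w ∧ k ≤ c ∧ c ≤ w ∧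
    x = sInf {y | ∃ a : A, k ≤ e a ∧ e a ≤ w ∧ y = e (f a)}}

/-- The `π`-extension of a map `f : A → A`. -/
def piExt (e : BoundedLatticeHom A C) (f : A → A) (c : C) : C :=
  sInf {x | ∃ k w, IsClosedElem e k ∧ IsOpenElem e w ∧ k ≤ c ∧ c ≤ w ∧
    x = sSup {y | ∃ a : A, k ≤ e a ∧ e a ≤ w ∧ y = e (f a)}}

/-- The diamond of the canonical extension. -/
def diaC (e : BoundedLatticeHom A C) : C → C := sigmaExt e ModalBiheytingAlgebra.dia

/-- The box of the canonical extension. -/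
def boxC (e : BoundedLatticeHom A C) : C → C := piExt e ModalBiheytingAlgebra.box

/-- The black box: the right adjoint of the diamond on the canonical extension. -/
def bboxC (e : BoundedLatticeHom A C) (b : C) : C := sSup {a | diaC e a ≤ b}

/-- The black diamond: the left adjoint of the box on the canonical extension. -/
def bdiaC (e : BoundedLatticeHom A C) (a : C) : C := sInf {b | a ≤ boxC e b}

end CanonicalExtension

/-! ## Languages

Formulas are well scoped: the free fixed point (or placeholder) variables of a formula of type
`Term n` or `XTerm n` are indexed by `Fin n`, and a binder binds the variable with index `0`.
Formulas of type `Term 0` and `XTerm 0` are the sentences. Propositional variables, nominals and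
co-nominals are named by natural numbers. -/

/-- Raw formulas of the language of modal bi-Heyting algebras with fixed point binders. Read with
the binders `μ, ν` they are formulas of `𝓛₁`, and with `μ₂, ν₂` formulas of `𝓛₂`. -/
inductive Term : ℕ → Type
  | bot {n : ℕ} : Term n
  | top {n : ℕ} : Term n
  | prop {n : ℕ} (p : ℕ) : Term n
  | fvar {n : ℕ} (x : Fin n) : Term n
  | conj {n : ℕ} (s t : Term n) : Term n
  | disj {n : ℕ} (s t : Term n) : Term n
  | imp {n : ℕ} (s t : Term n) : Term n
  | sub {n : ℕ} (s t : Term n) : Term n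
  | dia {n : ℕ} (t : Term n) : Term n
  | box {n : ℕ} (t : Term n) : Term n
  | mu {n : ℕ} (t : Term (n + 1)) : Term n
  | nu {n : ℕ} (t : Term (n + 1)) : Term n

/-- Raw formulas of the extended language `𝓛⁺_*`, with nominals, co-nominals, the black box, the
black diamond, and the binders `μ*` and `ν*`. -/
inductive XTerm : ℕ → Type
  | bot {n : ℕ} : XTerm n
  | top {n : ℕ} : XTerm n
  | prop {n : ℕ} (p : ℕ) : XTerm n
  | nom {n : ℕ} (i : ℕ) : XTerm n
  | conom {n : ℕ} (m : ℕ) : XTerm n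
  | fvar {n : ℕ} (x : Fin n) : XTerm n
  | conj {n : ℕ} (s t : XTerm n) : XTerm n
  | disj {n : ℕ} (s t : XTerm n) : XTerm n
  | imp {n : ℕ} (s t : XTerm n) : XTerm n
  | sub {n : ℕ} (s t : XTerm n) : XTerm n
  | dia {n : ℕ} (t : XTerm n) : XTerm n
  | box {n : ℕ} (t : XTerm n) : XTerm n
  | bbox {n : ℕ} (t : XTerm n) : XTerm n
  | bdia {n : ℕ} (t : XTerm n) : XTerm n
  | mu {n : ℕ} (t : XTerm (n + 1)) : XTerm n
  | nu {n : ℕ} (t : XTerm (n + 1)) : XTerm n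

namespace Term

/-- `SignedVar s x t`: in the positive generation tree of `t`, all nodes labelled with the free
fixed point variable `x` are signed `s` (`true` for `+`, `false` for `-`). -/
def SignedVar : {n : ℕ} → Bool → Fin n → Term n → Prop
  | _, _, _, bot => True
  | _, _, _, top => True
  | _, _, _, prop _ => True
  | _, s, x, fvar y => y = x → s = true
  | _, s, x, conj t t' => SignedVar s x t ∧ SignedVar s x t'
  | _, s, x, disj t t' => SignedVar s x t ∧ SignedVar s x t'
  | _, s, x, imp t t' => SignedVar (!s) x t ∧ SignedVar s x t'
  | _, s, x, sub t t' => SignedVar s x t ∧ SignedVar (!s) x t'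
  | _, s, x, dia t => SignedVar s x t
  | _, s, x, box t => SignedVar s x t
  | _, s, x, mu t => SignedVar s x.succ t
  | _, s, x, nu t => SignedVar s x.succ t

/-- The formation condition of the languages with binders: `μX.t` and `νX.t` are formed only
when `t` is positive in `X`. -/
def WF : {n : ℕ} → Term n → Prop
  | _, bot => True
  | _, top => True
  | _, prop _ => True
  | _, fvar _ => True
  | _, conj t t' => WF t ∧ WF t'
  | _, disj t t' => WF t ∧ WF t'
  | _, imp t t' => WF t ∧ WF t'
  | _, sub t t' => WF t ∧ WF t'
  | _, dia t => WF t
  | _, box t => WF t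
  | _, mu t => SignedVar true 0 t ∧ WF t
  | _, nu t => SignedVar true 0 t ∧ WF t

/-- The propositional variables occurring in a formula. -/
def props : {n : ℕ} → Term n → Set ℕ
  | _, bot => ∅
  | _, top => ∅
  | _, prop p => {p}
  | _, fvar _ => ∅
  | _, conj t t' => props t ∪ props t'
  | _, disj t t' => props t ∪ props t'
  | _, imp t t' => props t ∪ props t'
  | _, sub t t' => props t ∪ props t'
  | _, dia t => props t
  | _, box t => props t
  | _, mu t => props t
  | _, nu t => props t

/-- `t ↦ t*`: replace `μ` and `ν` by `μ*` and `ν*`. The formulas in the image are those of `𝓛_*`. -/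
def star : {n : ℕ} → Term n → XTerm n
  | _, bot => .bot
  | _, top => .top
  | _, prop p => .prop p
  | _, fvar x => .fvar x
  | _, conj t t' => .conj (star t) (star t')
  | _, disj t t' => .disj (star t) (star t')
  | _, imp t t' => .imp (star t) (star t')
  | _, sub t t' => .sub (star t) (star t')
  | _, dia t => .dia (star t)
  | _, box t => .box (star t)
  | _, mu t => .mu (star t)
  | _, nu t => .nu (star t)

section Interpretation

variable {A : Type u} [ModalBiheytingAlgebra A]

/-- `Denotes₁ v t ρ a`: read as a formula of `𝓛₁`, `t` is defined in `A` and has the value `a`,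
when the propositional variables take the values `v` and the free variables the values `ρ`. -/
def Denotes₁ (v : ℕ → A) : {n : ℕ} → Term n → (Fin n → A) → A → Prop
  | _, bot, _, a => a = ⊥
  | _, top, _, a => a = ⊤
  | _, prop p, _, a => a = v p
  | _, fvar x, ρ, a => a = ρ x
  | _, conj t t', ρ, a => ∃ b c, Denotes₁ v t ρ b ∧ Denotes₁ v t' ρ c ∧ a = b ⊓ c
  | _, disj t t', ρ, a => ∃ b c, Denotes₁ v t ρ b ∧ Denotes₁ v t' ρ c ∧ a = b ⊔ c
  | _, imp t t', ρ, a => ∃ b c, Denotes₁ v t ρ b ∧ Denotes₁ v t' ρ c ∧ a = b ⇨ c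
  | _, sub t t', ρ, a => ∃ b c, Denotes₁ v t ρ b ∧ Denotes₁ v t' ρ c ∧ a = b \ c
  | _, dia t, ρ, a => ∃ b, Denotes₁ v t ρ b ∧ a = ModalBiheytingAlgebra.dia b
  | _, box t, ρ, a => ∃ b, Denotes₁ v t ρ b ∧ a = ModalBiheytingAlgebra.box b
  | _, mu t, ρ, a => IsGLB {b | ∃ c, Denotes₁ v t (Fin.cons b ρ) c ∧ c ≤ b} a
  | _, nu t, ρ, a => IsLUB {b | ∃ c, Denotes₁ v t (Fin.cons b ρ) c ∧ b ≤ c} a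

/-- `Denotes₂ v t ρ a`: read as a formula of `𝓛₂`, `t` is defined in `A` and has the value `a`,
when the propositional variables take the values `v` and the free variables the values `ρ`. In the
clauses for the binders, `s α` is the `α`-th approximant. -/
def Denotes₂ (v : ℕ → A) : {n : ℕ} → Term n → (Fin n → A) → A → Prop
  | _, bot, _, a => a = ⊥
  | _, top, _, a => a = ⊤
  | _, prop p, _, a => a = v p
  | _, fvar x, ρ, a => a = ρ x
  | _, conj t t', ρ, a => ∃ b c, Denotes₂ v t ρ b ∧ Denotes₂ v t' ρ c ∧ a = b ⊓ c
  | _, disj t t', ρ, a => ∃ b c, Denotes₂ v t ρ b ∧ Denotes₂ v t' ρ c ∧ a = b ⊔ c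
  | _, imp t t', ρ, a => ∃ b c, Denotes₂ v t ρ b ∧ Denotes₂ v t' ρ c ∧ a = b ⇨ c
  | _, sub t t', ρ, a => ∃ b c, Denotes₂ v t ρ b ∧ Denotes₂ v t' ρ c ∧ a = b \ c
  | _, dia t, ρ, a => ∃ b, Denotes₂ v t ρ b ∧ a = ModalBiheytingAlgebra.dia b
  | _, box t, ρ, a => ∃ b, Denotes₂ v t ρ b ∧ a = ModalBiheytingAlgebra.box b
  | _, mu t, ρ, a => ∃ s : Ordinal.{u} → A, s 0 = ⊥ ∧
      (∀ α, Denotes₂ v t (Fin.cons (s α) ρ) (s (Order.succ α))) ∧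
      (∀ l, Order.IsSuccLimit l → IsLUB (s '' Set.Iio l) (s l)) ∧ IsLUB (Set.range s) a
  | _, nu t, ρ, a => ∃ s : Ordinal.{u} → A, s 0 = ⊤ ∧
      (∀ α, Denotes₂ v t (Fin.cons (s α) ρ) (s (Order.succ α))) ∧
      (∀ l, Order.IsSuccLimit l → IsGLB (s '' Set.Iio l) (s l)) ∧ IsGLB (Set.range s) a

end Interpretation

end Term

/-- Mu-algebras of the first kind: every formula of `𝓛₁` is everywhere defined. -/
def IsFirstKind (A : Type u) [ModalBiheytingAlgebra A] : Prop :=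
  ∀ (n : ℕ) (t : Term n), t.WF → ∀ (v : ℕ → A) (ρ : Fin n → A), ∃ a, t.Denotes₁ v ρ a

/-- Mu-algebras of the second kind: every formula of `𝓛₂` is everywhere defined. -/
def IsSecondKind (A : Type u) [ModalBiheytingAlgebra A] : Prop :=
  ∀ (n : ℕ) (t : Term n), t.WF → ∀ (v : ℕ → A) (ρ : Fin n → A), ∃ a, t.Denotes₂ v ρ a

namespace XTerm

/-- The propositional variables occurring in a formula. -/
def props : {n : ℕ} → XTerm n → Set ℕ
  | _, bot => ∅
  | _, top => ∅
  | _, prop p => {p}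
  | _, nom _ => ∅
  | _, conom _ => ∅
  | _, fvar _ => ∅
  | _, conj t t' => props t ∪ props t'
  | _, disj t t' => props t ∪ props t'
  | _, imp t t' => props t ∪ props t'
  | _, sub t t' => props t ∪ props t'
  | _, dia t => props t
  | _, box t => props t
  | _, bbox t => props t
  | _, bdia t => props t
  | _, mu t => props t
  | _, nu t => props t

/-- The nominals occurring in a formula. -/
def noms : {n : ℕ} → XTerm n → Set ℕ
  | _, bot => ∅
  | _, top => ∅
  | _, prop _ => ∅
  | _, nom i => {i}
  | _, conom _ => ∅
  | _, fvar _ => ∅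
  | _, conj t t' => noms t ∪ noms t'
  | _, disj t t' => noms t ∪ noms t'
  | _, imp t t' => noms t ∪ noms t'
  | _, sub t t' => noms t ∪ noms t'
  | _, dia t => noms t
  | _, box t => noms t
  | _, bbox t => noms t
  | _, bdia t => noms t
  | _, mu t => noms t
  | _, nu t => noms t

/-- The co-nominals occurring in a formula. -/
def conoms : {n : ℕ} → XTerm n → Set ℕ
  | _, bot => ∅
  | _, top => ∅
  | _, prop _ => ∅
  | _, nom _ => ∅
  | _, conom m => {m}
  | _, fvar _ => ∅
  | _, conj t t' => conoms t ∪ conoms t'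
  | _, disj t t' => conoms t ∪ conoms t'
  | _, imp t t' => conoms t ∪ conoms t'
  | _, sub t t' => conoms t ∪ conoms t'
  | _, dia t => conoms t
  | _, box t => conoms t
  | _, bbox t => conoms t
  | _, bdia t => conoms t
  | _, mu t => conoms t
  | _, nu t => conoms t

/-- `SignedProp s p t`: in the positive generation tree of `t`, all nodes labelled with the
propositional variable `p` are signed `s` (`true` for `+`, `false` for `-`). -/
def SignedProp : {n : ℕ} → Bool → ℕ → XTerm n → Prop
  | _, _, _, bot => True
  | _, _, _, top => True
  | _, s, p, prop q => q = p → s = true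
  | _, _, _, nom _ => True
  | _, _, _, conom _ => True
  | _, _, _, fvar _ => True
  | _, s, p, conj t t' => SignedProp s p t ∧ SignedProp s p t'
  | _, s, p, disj t t' => SignedProp s p t ∧ SignedProp s p t'
  | _, s, p, imp t t' => SignedProp (!s) p t ∧ SignedProp s p t'
  | _, s, p, sub t t' => SignedProp s p t ∧ SignedProp (!s) p t'
  | _, s, p, dia t => SignedProp s p t
  | _, s, p, box t => SignedProp s p t
  | _, s, p, bbox t => SignedProp s p t
  | _, s, p, bdia t => SignedProp s p t
  | _, s, p, mu t => SignedProp s p t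
  | _, s, p, nu t => SignedProp s p t

/-- `t` is positive in the propositional variable `p`. -/
def PosIn {n : ℕ} (p : ℕ) (t : XTerm n) : Prop := SignedProp true p t

/-- `t` is negative in the propositional variable `p`. -/
def NegIn {n : ℕ} (p : ℕ) (t : XTerm n) : Prop := SignedProp false p t

mutual

/-- Syntactically open formulas. -/
def SynOpen : {n : ℕ} → XTerm n → Prop
  | _, bot => True
  | _, top => True
  | _, prop _ => True
  | _, nom _ => False
  | _, conom _ => True
  | _, fvar _ => True
  | _, conj t t' => SynOpen t ∧ SynOpen t'
  | _, disj t t' => SynOpen t ∧ SynOpen t'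
  | _, imp t t' => SynClosed t ∧ SynOpen t'
  | _, sub t t' => SynOpen t ∧ SynClosed t'
  | _, dia t => SynOpen t
  | _, box t => SynOpen t
  | _, bbox t => SynOpen t
  | _, bdia _ => False
  | _, mu _ => False
  | _, nu t => SynOpen t

/-- Syntactically closed formulas. -/
def SynClosed : {n : ℕ} → XTerm n → Prop
  | _, bot => True
  | _, top => True
  | _, prop _ => True
  | _, nom _ => True
  | _, conom _ => False
  | _, fvar _ => True
  | _, conj t t' => SynClosed t ∧ SynClosed t'
  | _, disj t t' => SynClosed t ∧ SynClosed t'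
  | _, imp t t' => SynOpen t ∧ SynClosed t'
  | _, sub t t' => SynClosed t ∧ SynOpen t'
  | _, dia t => SynClosed t
  | _, box t => SynClosed t
  | _, bbox _ => False
  | _, bdia t => SynClosed t
  | _, mu t => SynClosed t
  | _, nu _ => False

end

/-- Renaming of free fixed point variables. -/
def rename : {n m : ℕ} → XTerm n → (Fin n → Fin m) → XTerm m
  | _, _, bot, _ => bot
  | _, _, top, _ => top
  | _, _, prop p, _ => prop p
  | _, _, nom i, _ => nom i
  | _, _, conom i, _ => conom i
  | _, _, fvar x, f => fvar (f x)
  | _, _, conj t t', f => conj (rename t f) (rename t' f)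
  | _, _, disj t t', f => disj (rename t f) (rename t' f)
  | _, _, imp t t', f => imp (rename t f) (rename t' f)
  | _, _, sub t t', f => sub (rename t f) (rename t' f)
  | _, _, dia t, f => dia (rename t f)
  | _, _, box t, f => box (rename t f)
  | _, _, bbox t, f => bbox (rename t f)
  | _, _, bdia t, f => bdia (rename t f)
  | _, _, mu t, f => mu (rename t (Fin.cons 0 fun k => (f k).succ))
  | _, _, nu t, f => nu (rename t (Fin.cons 0 fun k => (f k).succ))

/-- Simultaneous (capture-avoiding) substitution for the free fixed point or placeholder
variables. -/
def subst : {n m : ℕ} → XTerm n → (Fin n → XTerm m) → XTerm m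
  | _, _, bot, _ => bot
  | _, _, top, _ => top
  | _, _, prop p, _ => prop p
  | _, _, nom i, _ => nom i
  | _, _, conom i, _ => conom i
  | _, _, fvar x, f => f x
  | _, _, conj t t', f => conj (subst t f) (subst t' f)
  | _, _, disj t t', f => disj (subst t f) (subst t' f)
  | _, _, imp t t', f => imp (subst t f) (subst t' f)
  | _, _, sub t t', f => sub (subst t f) (subst t' f)
  | _, _, dia t, f => dia (subst t f)
  | _, _, box t, f => box (subst t f)
  | _, _, bbox t, f => bbox (subst t f)
  | _, _, bdia t, f => bdia (subst t f)
  | _, _, mu t, f => mu (subst t (Fin.cons (fvar 0) fun k => (f k).rename Fin.succ))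
  | _, _, nu t, f => nu (subst t (Fin.cons (fvar 0) fun k => (f k).rename Fin.succ))

/-- `t.substProp p α` is `t(α/p)`, where the propositional variable `p` is replaced by the
sentence `α`. -/
def substProp : {n : ℕ} → XTerm n → ℕ → XTerm 0 → XTerm n
  | _, bot, _, _ => bot
  | _, top, _, _ => top
  | _, prop q, p, α => if q = p then α.rename Fin.elim0 else prop q
  | _, nom i, _, _ => nom i
  | _, conom i, _, _ => conom i
  | _, fvar x, _, _ => fvar x
  | _, conj t t', p, α => conj (substProp t p α) (substProp t' p α)
  | _, disj t t', p, α => disj (substProp t p α) (substProp t' p α)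
  | _, imp t t', p, α => imp (substProp t p α) (substProp t' p α)
  | _, sub t t', p, α => sub (substProp t p α) (substProp t' p α)
  | _, dia t, p, α => dia (substProp t p α)
  | _, box t, p, α => box (substProp t p α)
  | _, bbox t, p, α => bbox (substProp t p α)
  | _, bdia t, p, α => bdia (substProp t p α)
  | _, mu t, p, α => mu (substProp t p α)
  | _, nu t, p, α => nu (substProp t p α)

/-- The disjunction of a finite list of formulas; the empty disjunction is `⊥`. -/
def bigDisj : List (XTerm 0) → XTerm 0
  | [] => bot
  | [α] => α
  | α :: β :: l => disj α (bigDisj (β :: l))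

/-- The conjunction of a finite list of formulas; the empty conjunction is `⊤`. -/
def bigConj : List (XTerm 0) → XTerm 0
  | [] => top
  | [α] => α
  | α :: β :: l => conj α (bigConj (β :: l))

end XTerm

/-! ## Assignments and interpretation in the canonical extension -/

/-- Values for the propositional variables, nominals and co-nominals. -/
structure Valuation (C : Type v) where
  prop : ℕ → C
  nom : ℕ → C
  conom : ℕ → C

section Semantics

variable {A : Type u} [ModalBiheytingAlgebra A] {C : Type v} [CompletelyDistribLattice C]

/-- Admissible assignments: nominals take completely join-irreducible values, co-nominals
completely meet-irreducible values, and propositional variables values in `A`. -/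
structure Valuation.IsAdmissible (e : BoundedLatticeHom A C) (V : Valuation C) : Prop where
  nom : ∀ i, IsCJI (V.nom i)
  conom : ∀ m, IsCMI (V.conom m)
  prop : ∀ p, V.prop p ∈ Set.range e

/-- The interpretation of `𝓛⁺_*` in the canonical extension. The binders `μ*` and `ν*` only take
into account pre- and post-fixed points that belong to `A`. -/
def XTerm.eval (e : BoundedLatticeHom A C) (V : Valuation C) :
    {n : ℕ} → XTerm n → (Fin n → C) → C
  | _, .bot, _ => ⊥
  | _, .top, _ => ⊤
  | _, .prop p, _ => V.prop p
  | _, .nom i, _ => V.nom i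
  | _, .conom m, _ => V.conom m
  | _, .fvar x, ρ => ρ x
  | _, .conj t t', ρ => XTerm.eval e V t ρ ⊓ XTerm.eval e V t' ρ
  | _, .disj t t', ρ => XTerm.eval e V t ρ ⊔ XTerm.eval e V t' ρ
  | _, .imp t t', ρ => XTerm.eval e V t ρ ⇨ XTerm.eval e V t' ρ
  | _, .sub t t', ρ => XTerm.eval e V t ρ \ XTerm.eval e V t' ρ
  | _, .dia t, ρ => diaC e (XTerm.eval e V t ρ)
  | _, .box t, ρ => boxC e (XTerm.eval e V t ρ)
  | _, .bbox t, ρ => bboxC e (XTerm.eval e V t ρ)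
  | _, .bdia t, ρ => bdiaC e (XTerm.eval e V t ρ)
  | _, .mu t, ρ => sInf {c | ∃ a : A, c = e a ∧ XTerm.eval e V t (Fin.cons (e a) ρ) ≤ e a}
  | _, .nu t, ρ => sSup {c | ∃ a : A, c = e a ∧ e a ≤ XTerm.eval e V t (Fin.cons (e a) ρ)}

end Semantics

/-! ## Inequalities and quasi-inequalities -/

/-- Inequalities `lhs ≤ rhs` between sentences of `𝓛⁺_*`. -/
structure Ineq where
  lhs : XTerm 0
  rhs : XTerm 0

/-- Formal inequalities. -/
infix:50 " ≼ " => Ineq.mk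

/-- Quasi-inequalities: a finite conjunction of inequalities implies an inequality. -/
structure QIneq where
  ants : List Ineq
  con : Ineq

/-- The propositional variables of an inequality. -/
def Ineq.props (x : Ineq) : Set ℕ := x.lhs.props ∪ x.rhs.props

/-- The nominals of a quasi-inequality. -/
def QIneq.noms (q : QIneq) : Set ℕ := {i | ∃ x ∈ q.con :: q.ants, i ∈ x.lhs.noms ∪ x.rhs.noms}

/-- The co-nominals of a quasi-inequality. -/
def QIneq.conoms (q : QIneq) : Set ℕ :=
  {m | ∃ x ∈ q.con :: q.ants, m ∈ x.lhs.conoms ∪ x.rhs.conoms}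

section Validity

variable {A : Type u} [ModalBiheytingAlgebra A] {C : Type v} [CompletelyDistribLattice C]

/-- Truth of an inequality under an assignment. -/
def Ineq.Holds (e : BoundedLatticeHom A C) (V : Valuation C) (x : Ineq) : Prop :=
  x.lhs.eval e V Fin.elim0 ≤ x.rhs.eval e V Fin.elim0

/-- Admissible validity of an inequality. -/
def Ineq.AdmValid (e : BoundedLatticeHom A C) (x : Ineq) : Prop :=
  ∀ V : Valuation C, V.IsAdmissible e → x.Holds e V

/-- Admissible validity of a quasi-inequality. -/
def QIneq.AdmValid (e : BoundedLatticeHom A C) (q : QIneq) : Prop :=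
  ∀ V : Valuation C, V.IsAdmissible e → (∀ x ∈ q.ants, x.Holds e V) → q.con.Holds e V

end Validity

/-! ## The rules -/

/-- First approximation of `φ* ≤ ψ*`, with the nominal `i` and the co-nominal `m`. -/
def firstApprox (φ ψ : Term 0) (i m : ℕ) : QIneq where
  ants := [.nom i ≼ φ.star, ψ.star ≼ .conom m]
  con := .nom i ≼ .conom m

open XTerm in
/-- One application of a rule, other than a fixed point approximation rule, to a
quasi-inequality. The rules act on the inequalities of the antecedent. The existential quantifiers
of the rules turn into universal ones in front of the quasi-inequality and are absorbed by the
notion of validity; accordingly a new nominal or co-nominal has to be fresh. -/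
inductive OrdStep : QIneq → QIneq → Prop
  /-- Conjunction of inequalities is associative, commutative and idempotent. -/
  | rearrange {Γ Γ' : List Ineq} {c : Ineq} (h : ∀ x, x ∈ Γ ↔ x ∈ Γ') : OrdStep ⟨Γ, c⟩ ⟨Γ', c⟩
  /-- Residuation rules; the rules for meet on the left and join on the right are also given with
  the two arguments exchanged. -/
  | subLR (χ ψ φ : XTerm 0) (Γ : List Ineq) (c : Ineq) :
      OrdStep ⟨(sub χ ψ ≼ φ) :: Γ, c⟩ ⟨(χ ≼ disj ψ φ) :: Γ, c⟩
  | impRR (φ χ ψ : XTerm 0) (Γ : List Ineq) (c : Ineq) :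
      OrdStep ⟨(φ ≼ imp χ ψ) :: Γ, c⟩ ⟨(conj φ χ ≼ ψ) :: Γ, c⟩
  | conjLR (χ ψ φ : XTerm 0) (Γ : List Ineq) (c : Ineq) :
      OrdStep ⟨(conj χ ψ ≼ φ) :: Γ, c⟩ ⟨(χ ≼ imp ψ φ) :: Γ, c⟩
  | conjLR' (χ ψ φ : XTerm 0) (Γ : List Ineq) (c : Ineq) :
      OrdStep ⟨(conj χ ψ ≼ φ) :: Γ, c⟩ ⟨(ψ ≼ imp χ φ) :: Γ, c⟩
  | disjRR (φ χ ψ : XTerm 0) (Γ : List Ineq) (c : Ineq) :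
      OrdStep ⟨(φ ≼ disj χ ψ) :: Γ, c⟩ ⟨(sub φ χ ≼ ψ) :: Γ, c⟩
  | disjRR' (φ χ ψ : XTerm 0) (Γ : List Ineq) (c : Ineq) :
      OrdStep ⟨(φ ≼ disj χ ψ) :: Γ, c⟩ ⟨(sub φ ψ ≼ χ) :: Γ, c⟩
  /-- Adjunction rules. -/
  | disjLA (φ χ ψ : XTerm 0) (Γ : List Ineq) (c : Ineq) :
      OrdStep ⟨(disj φ χ ≼ ψ) :: Γ, c⟩ ⟨(φ ≼ ψ) :: (χ ≼ ψ) :: Γ, c⟩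
  | conjRA (ψ φ χ : XTerm 0) (Γ : List Ineq) (c : Ineq) :
      OrdStep ⟨(ψ ≼ conj φ χ) :: Γ, c⟩ ⟨(ψ ≼ φ) :: (ψ ≼ χ) :: Γ, c⟩
  | diaLA (φ ψ : XTerm 0) (Γ : List Ineq) (c : Ineq) :
      OrdStep ⟨(dia φ ≼ ψ) :: Γ, c⟩ ⟨(φ ≼ bbox ψ) :: Γ, c⟩
  | boxRA (φ ψ : XTerm 0) (Γ : List Ineq) (c : Ineq) :
      OrdStep ⟨(φ ≼ box ψ) :: Γ, c⟩ ⟨(bdia φ ≼ ψ) :: Γ, c⟩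
  /-- Approximation rules. -/
  | boxAppr (ψ : XTerm 0) (m n : ℕ) (Γ : List Ineq) (c : Ineq)
      (hn : n ∉ QIneq.conoms ⟨(box ψ ≼ conom m) :: Γ, c⟩) :
      OrdStep ⟨(box ψ ≼ conom m) :: Γ, c⟩
        ⟨(box (conom n) ≼ conom m) :: (ψ ≼ conom n) :: Γ, c⟩
  | diaAppr (ψ : XTerm 0) (j i : ℕ) (Γ : List Ineq) (c : Ineq)
      (hi : i ∉ QIneq.noms ⟨(nom j ≼ dia ψ) :: Γ, c⟩) :
      OrdStep ⟨(nom j ≼ dia ψ) :: Γ, c⟩ ⟨(nom j ≼ dia (nom i)) :: (nom i ≼ ψ) :: Γ, c⟩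
  | impAppr (χ φ : XTerm 0) (m j n : ℕ) (Γ : List Ineq) (c : Ineq)
      (hj : j ∉ QIneq.noms ⟨(imp χ φ ≼ conom m) :: Γ, c⟩)
      (hn : n ∉ QIneq.conoms ⟨(imp χ φ ≼ conom m) :: Γ, c⟩) :
      OrdStep ⟨(imp χ φ ≼ conom m) :: Γ, c⟩
        ⟨(imp (nom j) (conom n) ≼ conom m) :: (nom j ≼ χ) :: (φ ≼ conom n) :: Γ, c⟩
  | subAppr (χ φ : XTerm 0) (i j n : ℕ) (Γ : List Ineq) (c : Ineq)
      (hj : j ∉ QIneq.noms ⟨(nom i ≼ sub χ φ) :: Γ, c⟩)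
      (hn : n ∉ QIneq.conoms ⟨(nom i ≼ sub χ φ) :: Γ, c⟩) :
      OrdStep ⟨(nom i ≼ sub χ φ) :: Γ, c⟩
        ⟨(nom i ≼ sub (nom j) (conom n)) :: (nom j ≼ χ) :: (φ ≼ conom n) :: Γ, c⟩
  /-- The right Ackermann rule, eliminating `p`; the inequalities in `B` are the `β ≤ γ`. -/
  | rightAckermann (p : ℕ) (αs : List (XTerm 0)) (B Γ : List Ineq) (c : Ineq)
      (hα : ∀ α ∈ αs, p ∉ α.props ∧ α.SynClosed)
      (hβ : ∀ x ∈ B, x.lhs.PosIn p ∧ x.lhs.SynClosed)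
      (hγ : ∀ x ∈ B, x.rhs.NegIn p ∧ x.rhs.SynOpen)
      (hΓ : ∀ x ∈ Γ, p ∉ x.props) (hc : p ∉ c.props) :
      OrdStep ⟨αs.map (fun α => α ≼ prop p) ++ B ++ Γ, c⟩
        ⟨B.map (fun x => x.lhs.substProp p (bigDisj αs) ≼ x.rhs.substProp p (bigDisj αs)) ++ Γ, c⟩
  /-- The left Ackermann rule, eliminating `p`; the inequalities in `B` are the `γ ≤ β`. -/
  | leftAckermann (p : ℕ) (αs : List (XTerm 0)) (B Γ : List Ineq) (c : Ineq)
      (hα : ∀ α ∈ αs, p ∉ α.props ∧ α.SynOpen)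
      (hβ : ∀ x ∈ B, x.rhs.PosIn p ∧ x.rhs.SynOpen)
      (hγ : ∀ x ∈ B, x.lhs.NegIn p ∧ x.lhs.SynClosed)
      (hΓ : ∀ x ∈ Γ, p ∉ x.props) (hc : p ∉ c.props) :
      OrdStep ⟨αs.map (fun α => prop p ≼ α) ++ B ++ Γ, c⟩
        ⟨B.map (fun x => x.lhs.substProp p (bigConj αs) ≼ x.rhs.substProp p (bigConj αs)) ++ Γ, c⟩

/-! ### Fixed point approximation rules -/

/-- The entries `1` and `∂` of order types. -/
inductive OType
  | one
  | dual

/-- Joins in `C^τ`: computed in `C` in the coordinates of type `1`, and in the order dual of `C`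
in those of type `∂`. -/
def tauSup {C : Type v} [CompleteLattice C] {n : ℕ} (τ : Fin n → OType) (S : Set (Fin n → C)) :
    Fin n → C := fun k =>
  match τ k with
  | .one => sSup ((fun ρ => ρ k) '' S)
  | .dual => sInf ((fun ρ => ρ k) '' S)

/-- Meets in `C^τ`. -/
def tauInf {C : Type v} [CompleteLattice C] {n : ℕ} (τ : Fin n → OType) (S : Set (Fin n → C)) :
    Fin n → C := fun k =>
  match τ k with
  | .one => sInf ((fun ρ => ρ k) '' S)
  | .dual => sSup ((fun ρ => ρ k) '' S)

/-- `f : C^τ → C` preserves all joins. -/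
def CompletelyJoinPreserving {C : Type v} [CompleteLattice C] {n : ℕ} (τ : Fin n → OType)
    (f : (Fin n → C) → C) : Prop :=
  ∀ S : Set (Fin n → C), f (tauSup τ S) = sSup (f '' S)

/-- `f : C^τ → C` preserves all meets. -/
def CompletelyMeetPreserving {C : Type v} [CompleteLattice C] {n : ℕ} (τ : Fin n → OType)
    (f : (Fin n → C) → C) : Prop :=
  ∀ S : Set (Fin n → C), f (tauInf τ S) = sInf (f '' S)

/-- The formula `⊥^ε`. -/
def botT : OType → XTerm 0
  | .one => .bot
  | .dual => .top

/-- The formula `⊤^ε`. -/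
def topT : OType → XTerm 0
  | .one => .top
  | .dual => .bot

/-- `j^ε`: a nominal if `ε = 1`, a co-nominal if `ε = ∂`. -/
def nomT : OType → ℕ → XTerm 0
  | .one, y => .nom y
  | .dual, y => .conom y

/-- `n^ε`: a co-nominal if `ε = 1`, a nominal if `ε = ∂`. -/
def conomT : OType → ℕ → XTerm 0
  | .one, y => .conom y
  | .dual, y => .nom y

/-- The inequality `s ≤^ε t`. -/
def leT : OType → XTerm 0 → XTerm 0 → Ineq
  | .one, s, t => s ≼ t
  | .dual, s, t => t ≼ s

/-- The tuple with `j^{τ_i}` in coordinate `i` and `⊥^{τ_k}` in every other coordinate `k`. -/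
def nomTuple {n : ℕ} (τ : Fin n → OType) (i : Fin n) (y : ℕ) : Fin n → XTerm 0 :=
  fun k => if k = i then nomT (τ i) y else botT (τ k)

/-- The tuple with `n^{τ_i}` in coordinate `i` and `⊤^{τ_k}` in every other coordinate `k`. -/
def conomTuple {n : ℕ} (τ : Fin n → OType) (i : Fin n) (y : ℕ) : Fin n → XTerm 0 :=
  fun k => if k = i then conomT (τ i) y else topT (τ k)

/-- The nominal or co-nominal `j^ε` named `y` does not occur in `q`. -/
def nomFresh (q : QIneq) : OType → ℕ → Prop
  | .one, y => y ∉ q.noms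
  | .dual, y => y ∉ q.conoms

/-- The co-nominal or nominal `n^ε` named `y` does not occur in `q`. -/
def conomFresh (q : QIneq) : OType → ℕ → Prop
  | .one, y => y ∉ q.conoms
  | .dual, y => y ∉ q.noms

section Derivations

variable {A : Type u} [ModalBiheytingAlgebra A] {C : Type v} [CompletelyDistribLattice C]

/-- One application of a rule to a quasi-inequality, producing a set of quasi-inequalities. In the
fixed point approximation rules, `X` is the variable with index `0` of the body `ψ` of the binder,
the placeholders `x₁, …, xₙ` are the variables with indices `1, …, n`, and the rule splits the
quasi-inequality into `n` quasi-inequalities. Both the body and the substituted sentences are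
formulas of `𝓛_*`. The term function of the body has to preserve joins (meets) on the canonical
extension given by `e`. -/
inductive Step (e : BoundedLatticeHom A C) : QIneq → Set QIneq → Prop
  | ord {q q' : QIneq} (h : OrdStep q q') : Step e q {q'}
  | muApprox {n : ℕ} (τ : Fin n → OType) (ψ : Term (n + 1)) (φ : Fin n → Term 0)
      (i : ℕ) (y : Fin n → ℕ) (Γ : List Ineq) (c : Ineq)
      (hψ : (Term.mu ψ).WF) (hφ : ∀ k, (φ k).WF) (hprops : ψ.props = ∅)
      (hpres : ∀ V : Valuation C, CompletelyJoinPreserving (Fin.cons .one τ) (ψ.star.eval e V))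
      (hfresh : ∀ k, nomFresh
        ⟨(.nom i ≼ (Term.mu ψ).star.subst fun l => (φ l).star) :: Γ, c⟩ (τ k) (y k)) :
      Step e ⟨(.nom i ≼ (Term.mu ψ).star.subst fun l => (φ l).star) :: Γ, c⟩
        (Set.range fun k : Fin n =>
          ⟨(.nom i ≼ (Term.mu ψ).star.subst (nomTuple τ k (y k))) ::
            leT (τ k) (nomT (τ k) (y k)) (φ k).star :: Γ, c⟩)
  | nuApprox {n : ℕ} (τ : Fin n → OType) (φ : Term (n + 1)) (ψ : Fin n → Term 0)
      (m : ℕ) (y : Fin n → ℕ) (Γ : List Ineq) (c : Ineq)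
      (hφ : (Term.nu φ).WF) (hψ : ∀ k, (ψ k).WF) (hprops : φ.props = ∅)
      (hpres : ∀ V : Valuation C, CompletelyMeetPreserving (Fin.cons .one τ) (φ.star.eval e V))
      (hfresh : ∀ k, conomFresh
        ⟨((Term.nu φ).star.subst (fun l => (ψ l).star) ≼ .conom m) :: Γ, c⟩ (τ k) (y k)) :
      Step e ⟨((Term.nu φ).star.subst (fun l => (ψ l).star) ≼ .conom m) :: Γ, c⟩
        (Set.range fun k : Fin n =>
          ⟨((Term.nu φ).star.subst (conomTuple τ k (y k)) ≼ .conom m) ::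
            leT (τ k) (ψ k).star (conomT (τ k) (y k)) :: Γ, c⟩)

/-- One application of a rule to a member of a set of quasi-inequalities. -/
def SetStep (e : BoundedLatticeHom A C) (Q Q' : Set QIneq) : Prop :=
  ∃ q ∈ Q, ∃ S : Set QIneq, Step e q S ∧ Q' = (Q \ {q}) ∪ S

/-- `Q'` is obtained from `Q` through finitely many rule applications. -/
def Derives (e : BoundedLatticeHom A C) : Set QIneq → Set QIneq → Prop :=
  Relation.ReflTransGen (SetStep e)

end Derivations

end MuALBA

/-!
Each rule is checked under an arbitrary admissible assignment in a canonical extension `C` of `A`.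
Residuation and adjunction rules are adjunctions in `C`; the approximation rules hold because every
element of `C` is a join of completely join-irreducible elements and a meet of completely
meet-irreducible ones, and the operations preserve or reverse these joins and meets. For the
Ackermann rules, a syntactically closed formula that is positive in `p` turns a down-directed meet
`⨅ aᵢ` of elements of `A`, substituted for `p`, into the meet of its values at the `aᵢ`, and a
syntactically open one that is negative in `p` turns it into a join. An inequality between them at a
closed element such as `⋁ αᵢ` therefore already holds, by compactness, at some element of `A`
above it.

Suppose `j ≤ μ*X.ψ(c, X)`, but `j` lies below none of the fixed points obtained by putting a
single irreducible in one coordinate. Each of these has a pre-fixed point `b` in `A` with `j ≰ b`;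
such `b` form a directed family `B` whose join is above `ψ(c, ⊥)`. In a mu-algebra of the second
kind `ψ(c, ⊥)` lies in `A`, so by compactness one `b` in `B` is above it; then `ψ(c, b) ≤ b`, so
`j ≤ b`, a contradiction.
-/

namespace MuALBA

/-- The order dual of a modal bi-Heyting algebra, with box and diamond exchanged. -/
instance ModalBiheytingAlgebra.orderDual {A : Type u} [ModalBiheytingAlgebra A] :
    ModalBiheytingAlgebra Aᵒᵈ where
  toBiheytingAlgebra := OrderDual.instBiheytingAlgebra
  box a := OrderDual.toDual (dia (OrderDual.ofDual a))
  dia a := OrderDual.toDual (box (OrderDual.ofDual a))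
  box_top := dia_bot (A := A)
  box_inf a b := dia_sup (OrderDual.ofDual a) (OrderDual.ofDual b)
  dia_bot := box_top (A := A)
  dia_sup a b := box_inf (OrderDual.ofDual a) (OrderDual.ofDual b)

theorem directed_map₂ {ι κ α β γ : Type*} {r : α → α → Prop} {s : β → β → Prop}
    {t : γ → γ → Prop} {f : ι → α} {g : κ → β} {op : α → β → γ} (hf : Directed r f)
    (hg : Directed s g) (hop : ∀ ⦃a a'⦄, r a a' → ∀ ⦃b b'⦄, s b b' → t (op a b) (op a' b')) :
    Directed t fun x : ι × κ => op (f x.1) (g x.2) := fun x y => by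
  obtain ⟨i, hxi, hyi⟩ := hf x.1 y.1
  obtain ⟨k, hxk, hyk⟩ := hg x.2 y.2
  exact ⟨(i, k), hop hxi hxk, hop hyi hyk⟩

section CanonicalExtension

variable {A : Type u} [ModalBiheytingAlgebra A] {C : Type v} [CompletelyDistribLattice C]
  {e : BoundedLatticeHom A C}

theorem IsCanonicalExtension.dual (he : IsCanonicalExtension e) :
    IsCanonicalExtension (A := Aᵒᵈ) (C := Cᵒᵈ) (BoundedLatticeHom.dual e) where
  injective := he.injective
  dense_join := he.dense_meet
  dense_meet := he.dense_join
  compact S T h :=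
    let ⟨T', S', hT, hS, hle⟩ := he.compact T S h
    ⟨S', T', hS, hT, hle⟩

theorem piExt_eq_sigmaExt_dual (f : A → A) (c : C) :
    piExt e f c = sigmaExt (A := Aᵒᵈ) (C := Cᵒᵈ) (BoundedLatticeHom.dual e) f c := by
  refine congrArg sInf (Set.ext fun x => ?_)
  constructor
  · rintro ⟨k, w, hk, hw, hkc, hcw, rfl⟩
    exact ⟨w, k, hw, hk, hcw, hkc,
      congrArg (sSup (α := C)) (Set.ext fun y => exists_congr fun a => and_left_comm)⟩
  · rintro ⟨w, k, hw, hk, hcw, hkc, rfl⟩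
    exact ⟨k, w, hk, hw, hkc, hcw,
      congrArg (sSup (α := C)) (Set.ext fun y => exists_congr fun a => and_left_comm)⟩

theorem boxC_eq_diaC_dual (c : C) :
    boxC e c = diaC (A := Aᵒᵈ) (C := Cᵒᵈ) (BoundedLatticeHom.dual e) c :=
  piExt_eq_sigmaExt_dual _ c

theorem diaC_eq_boxC_dual (c : C) :
    diaC e c = boxC (A := Aᵒᵈ) (C := Cᵒᵈ) (BoundedLatticeHom.dual e) c :=
  (boxC_eq_diaC_dual (A := Aᵒᵈ) (C := Cᵒᵈ) (e := BoundedLatticeHom.dual e) c).symm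

theorem bdiaC_eq_bboxC_dual (c : C) :
    bdiaC e c = bboxC (A := Aᵒᵈ) (C := Cᵒᵈ) (BoundedLatticeHom.dual e) c := by
  simp only [bdiaC, boxC_eq_diaC_dual]
  rfl

theorem bboxC_eq_bdiaC_dual (c : C) :
    bboxC e c = bdiaC (A := Aᵒᵈ) (C := Cᵒᵈ) (BoundedLatticeHom.dual e) c :=
  (bdiaC_eq_bboxC_dual (A := Aᵒᵈ) (C := Cᵒᵈ) (e := BoundedLatticeHom.dual e) c).symm

/-! ### Closed and open elements -/

theorem isClosedElem_iInf_map {ι : Sort*} (f : ι → A) : IsClosedElem e (⨅ i, e (f i)) :=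
  ⟨Set.range f, by rw [← Set.range_comp]; rfl⟩

theorem isClosedElem_map (a : A) : IsClosedElem e (e a) :=
  ⟨{a}, by simp⟩

theorem isOpenElem_map (a : A) : IsOpenElem e (e a) :=
  ⟨{a}, by simp⟩

theorem IsClosedElem.eq_iInf {k : C} (hk : IsClosedElem e k) :
    k = ⨅ a : {a // k ≤ e a}, e a := by
  obtain ⟨S, rfl⟩ := hk
  refine le_antisymm (le_iInf fun a => a.2) (le_sInf ?_)
  rintro _ ⟨a, ha, rfl⟩
  exact iInf_le_of_le ⟨a, sInf_le (Set.mem_image_of_mem e ha)⟩ le_rfl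

theorem IsOpenElem.eq_iSup {w : C} (hw : IsOpenElem e w) : w = ⨆ a : {a // e a ≤ w}, e a :=
  IsClosedElem.eq_iInf (A := Aᵒᵈ) (C := Cᵒᵈ) (e := BoundedLatticeHom.dual e) hw

theorem isClosedElem_sInf {S : Set C} (hS : ∀ k ∈ S, IsClosedElem e k) :
    IsClosedElem e (sInf S) := by
  refine ⟨{a | sInf S ≤ e a}, le_antisymm (le_sInf ?_) (le_sInf fun k hk => ?_)⟩
  · rintro _ ⟨a, ha, rfl⟩
    exact ha
  · rw [(hS k hk).eq_iInf]
    exact le_iInf fun a => sInf_le (Set.mem_image_of_mem e ((sInf_le hk).trans a.2))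

theorem IsClosedElem.inf {k l : C} (hk : IsClosedElem e k) (hl : IsClosedElem e l) :
    IsClosedElem e (k ⊓ l) := by
  rw [← sInf_pair]
  exact isClosedElem_sInf (by rintro x (rfl | rfl) <;> assumption)

theorem IsClosedElem.sup {k l : C} (hk : IsClosedElem e k) (hl : IsClosedElem e l) :
    IsClosedElem e (k ⊔ l) := by
  rw [hk.eq_iInf, hl.eq_iInf, iInf_sup_iInf]
  simp only [← map_sup]
  exact isClosedElem_iInf_map _

theorem IsOpenElem.sup {w z : C} (hw : IsOpenElem e w) (hz : IsOpenElem e z) :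
    IsOpenElem e (w ⊔ z) :=
  IsClosedElem.inf (A := Aᵒᵈ) (C := Cᵒᵈ) (e := BoundedLatticeHom.dual e) hw hz

instance (k : C) : Nonempty {a // k ≤ e a} := ⟨⟨⊤, by simp⟩⟩

instance (w : C) : Nonempty {a // e a ≤ w} := ⟨⟨⊥, by simp⟩⟩

instance (k : C) : IsCodirectedOrder {a // k ≤ e a} where
  directed a b := ⟨⟨a ⊓ b, by rw [map_inf]; exact le_inf a.2 b.2⟩,
    inf_le_left (α := A), inf_le_right (α := A)⟩

instance (w : C) : IsDirectedOrder {a // e a ≤ w} where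
  directed a b := ⟨⟨a ⊔ b, by rw [map_sup]; exact sup_le a.2 b.2⟩,
    le_sup_left (α := A), le_sup_right (α := A)⟩

theorem directed_ge_subtype_le_map (k : C) : Directed (· ≥ ·) fun a : {a // k ≤ e a} => (a : A) :=
  (Subtype.mono_coe _).directed_ge

theorem directed_le_subtype_map_le (w : C) : Directed (· ≤ ·) fun a : {a // e a ≤ w} => (a : A) :=
  (Subtype.mono_coe _).directed_le

namespace IsCanonicalExtension

variable (he : IsCanonicalExtension e)
include he

theorem map_le_map {a b : A} : e a ≤ e b ↔ a ≤ b := by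
  refine ⟨fun h => inf_eq_left.1 (he.injective ?_), fun h => OrderHomClass.mono e h⟩
  rw [map_inf, inf_eq_left.2 h]

theorem exists_finset_le {S : Set A} {w : C} (hw : IsOpenElem e w) (h : sInf (e '' S) ≤ w) :
    ∃ S' : Finset A, (S' : Set A) ⊆ S ∧ e (S'.inf id) ≤ w := by
  obtain ⟨T, rfl⟩ := hw
  obtain ⟨S', T', hS, hT, hle⟩ := he.compact S T h
  refine ⟨S', hS, (OrderHomClass.mono e hle).trans ?_⟩
  rw [map_finset_sup]
  exact Finset.sup_le fun a ha => le_sSup (Set.mem_image_of_mem e (hT ha))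

theorem exists_map_le {ι : Type*} [Nonempty ι] {f : ι → A} (hf : Directed (· ≥ ·) f) {w : C}
    (hw : IsOpenElem e w) (h : ⨅ i, e (f i) ≤ w) : ∃ i, e (f i) ≤ w := by
  classical
  obtain ⟨S, hS, hle⟩ := he.exists_finset_le (S := f '' Set.univ) hw (by rwa [Set.image_univ,
    ← Set.range_comp])
  obtain ⟨s, -, rfl⟩ := Finset.subset_set_image_iff.1 hS
  obtain ⟨i, hi⟩ := hf.finset_le s
  refine ⟨i, (he.map_le_map.2 ?_).trans hle⟩
  rw [Finset.inf_image]
  exact Finset.le_inf hi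

theorem exists_le_map {ι : Type*} [Nonempty ι] {f : ι → A} (hf : Directed (· ≤ ·) f) {k : C}
    (hk : IsClosedElem e k) (h : k ≤ ⨆ i, e (f i)) : ∃ i, k ≤ e (f i) :=
  he.dual.exists_map_le hf hk h

theorem exists_between {k w : C} (hk : IsClosedElem e k) (hw : IsOpenElem e w) (h : k ≤ w) :
    ∃ a, k ≤ e a ∧ e a ≤ w := by
  rw [hk.eq_iInf] at h
  obtain ⟨a, ha⟩ := he.exists_map_le (directed_ge_subtype_le_map k) hw h
  exact ⟨a, a.2, ha⟩

theorem le_of_forall_closed {c d : C} (h : ∀ k, IsClosedElem e k → k ≤ c → k ≤ d) : c ≤ d := by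
  obtain ⟨K, hK, rfl⟩ := he.dense_join c
  exact sSup_le fun k hk => h k (hK k hk) (le_sSup hk)

theorem le_of_forall_open {c d : C} (h : ∀ w, IsOpenElem e w → d ≤ w → c ≤ w) : c ≤ d :=
  he.dual.le_of_forall_closed h

theorem isClosedElem_of_forall_open {c : C}
    (h : ∀ w, IsOpenElem e w → c ≤ w → ∃ a, c ≤ e a ∧ e a ≤ w) : IsClosedElem e c := by
  suffices hc : c = ⨅ a : {a // c ≤ e a}, e a by
    rw [hc]
    exact isClosedElem_iInf_map _
  refine le_antisymm (le_iInf fun a => a.2) (he.le_of_forall_open fun w hw hcw => ?_)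
  obtain ⟨a, hca, haw⟩ := h w hw hcw
  exact iInf_le_of_le ⟨a, hca⟩ haw

theorem exists_map_inf_le {k l w : C} (hk : IsClosedElem e k) (hl : IsClosedElem e l)
    (hw : IsOpenElem e w) (h : k ⊓ l ≤ w) :
    ∃ a b, k ≤ e a ∧ l ≤ e b ∧ e (a ⊓ b) ≤ w := by
  have hkl : ⨅ x : {a // k ≤ e a} × {b // l ≤ e b}, e (x.1 ⊓ x.2) ≤ k ⊓ l := by
    conv_rhs => rw [hk.eq_iInf, hl.eq_iInf]
    simp only [iInf_prod, map_inf, iInf_inf, inf_iInf]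
    exact iInf_comm.le
  obtain ⟨⟨a, b⟩, hab⟩ := he.exists_map_le (directed_map₂ (directed_ge_subtype_le_map k)
    (directed_ge_subtype_le_map l) fun _ _ ha _ _ hb => inf_le_inf ha hb) hw (hkl.trans h)
  exact ⟨a, b, a.2, b.2, hab⟩

theorem exists_le_map_sup {w z k : C} (hw : IsOpenElem e w) (hz : IsOpenElem e z)
    (hk : IsClosedElem e k) (h : k ≤ w ⊔ z) : ∃ a b, e a ≤ w ∧ e b ≤ z ∧ k ≤ e (a ⊔ b) :=
  he.dual.exists_map_inf_le hw hz hk h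

theorem map_himp (a b : A) : e (a ⇨ b) = e a ⇨ e b := by
  refine le_antisymm ?_ (he.le_of_forall_closed fun k hk h => ?_)
  · rw [le_himp_iff, ← map_inf]
    exact OrderHomClass.mono e himp_inf_le
  · obtain ⟨c, d, hc, hd, hcd⟩ := he.exists_map_inf_le hk (isClosedElem_map a)
      (isOpenElem_map b) (le_himp_iff.1 h)
    refine hc.trans (he.map_le_map.2 (le_himp_iff.2 ?_))
    exact (inf_le_inf_left c (he.map_le_map.1 hd)).trans (he.map_le_map.1 hcd)

theorem map_sdiff (a b : A) : e (a \ b) = e a \ e b :=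
  he.dual.map_himp b a

theorem himp_eq_iInf {w k : C} (hw : IsOpenElem e w) (hk : IsClosedElem e k) :
    w ⇨ k = ⨅ x : {a // e a ≤ w} × {b // k ≤ e b}, e (x.1 ⇨ x.2) := by
  conv_lhs => rw [hw.eq_iSup, hk.eq_iInf]
  simp only [iSup_himp_eq, himp_iInf_eq, iInf_prod, he.map_himp]
  exact iInf_comm

theorem isClosedElem_himp {w k : C} (hw : IsOpenElem e w) (hk : IsClosedElem e k) :
    IsClosedElem e (w ⇨ k) := by
  rw [he.himp_eq_iInf hw hk]
  exact isClosedElem_iInf_map _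

theorem exists_map_himp_le {w k z : C} (hw : IsOpenElem e w) (hk : IsClosedElem e k)
    (hz : IsOpenElem e z) (h : w ⇨ k ≤ z) : ∃ a b, e a ≤ w ∧ k ≤ e b ∧ e (a ⇨ b) ≤ z := by
  rw [he.himp_eq_iInf hw hk] at h
  obtain ⟨⟨a, b⟩, hab⟩ := he.exists_map_le (directed_map₂ (directed_le_subtype_map_le w)
    (directed_ge_subtype_le_map k) fun _ _ ha _ _ hb => himp_le_himp ha hb) hz h
  exact ⟨a, b, a.2, b.2, hab⟩

theorem exists_map_sdiff_le {k w z : C} (hk : IsClosedElem e k) (hw : IsOpenElem e w)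
    (hz : IsOpenElem e z) (h : k \ w ≤ z) : ∃ a b, k ≤ e a ∧ e b ≤ w ∧ e (a \ b) ≤ z := by
  obtain ⟨a, hka, haw⟩ := he.exists_between hk (hw.sup hz) (sdiff_le_iff.1 h)
  obtain ⟨b, c, hb, hc, habc⟩ := he.exists_le_map_sup hw hz (isClosedElem_map a) haw
  exact ⟨a, b, hka, hb,
    (he.map_le_map.2 (sdiff_le_iff.2 (he.map_le_map.1 habc))).trans hc⟩

theorem isClosedElem_sdiff {k w : C} (hk : IsClosedElem e k) (hw : IsOpenElem e w) :
    IsClosedElem e (k \ w) := by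
  refine he.isClosedElem_of_forall_open fun z hz h => ?_
  obtain ⟨a, b, ha, hb, hab⟩ := he.exists_map_sdiff_le hk hw hz h
  refine ⟨a \ b, ?_, hab⟩
  rw [he.map_sdiff]
  exact sdiff_le_sdiff ha hb

end IsCanonicalExtension

/-! ### Completely irreducible elements -/

theorem IsCJI.exists_le {D : Type*} [CompletelyDistribLattice D] {j : D} (hj : IsCJI j)
    {S : Set D} (h : j ≤ sSup S) : ∃ x ∈ S, j ≤ x := by
  obtain ⟨_, ⟨x, hx, rfl⟩, hjx⟩ := hj ((j ⊓ ·) '' S) <| by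
    rw [sSup_image, ← inf_sSup_eq, inf_eq_left.2 h]
  exact ⟨x, hx, inf_eq_left.1 hjx.symm⟩

theorem IsCMI.exists_le {D : Type*} [CompletelyDistribLattice D] {m : D} (hm : IsCMI m)
    {S : Set D} (h : sInf S ≤ m) : ∃ x ∈ S, x ≤ m :=
  IsCJI.exists_le (D := Dᵒᵈ) hm h

namespace IsCanonicalExtension

variable (he : IsCanonicalExtension e)
include he

theorem not_iInf_compl_le_iSup_of_isPrime {J : Order.Ideal A} (hJ : J.IsPrime) :
    ¬ ⨅ a : ((J : Set A)ᶜ : Set A), e a ≤ ⨆ a : J, e a := fun hle => by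
  have : Nonempty ((J : Set A)ᶜ : Set A) :=
    (Order.PFilter.nonempty hJ.compl_filter.toPFilter).to_subtype
  have hF : DirectedOn (· ≥ ·) (J : Set A)ᶜ := Order.PFilter.directed hJ.compl_filter.toPFilter
  obtain ⟨a, ha⟩ := he.exists_map_le hF.directed_val ⟨_, (sSup_image' (f := e)).symm⟩ hle
  have : Nonempty J := J.nonempty.to_subtype
  obtain ⟨b, hb⟩ := he.exists_le_map J.directed.directed_val (isClosedElem_map _) ha
  exact a.2 (J.lower (he.map_le_map.1 hb) b.2)

theorem isCJI_iInf_compl {J : Order.Ideal A} (hJ : J.IsPrime) :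
    IsCJI (⨅ a : ((J : Set A)ᶜ : Set A), e a) := by
  set j : C := ⨅ a : ((J : Set A)ᶜ : Set A), e a
  have le_iSup_of_not_le {x : C} (hx : ¬ j ≤ x) : x ≤ ⨆ a : J, e a := by
    obtain ⟨w, hw, hxw, hjw⟩ : ∃ w, IsOpenElem e w ∧ x ≤ w ∧ ¬ j ≤ w := by
      by_contra! hcon
      exact hx (he.le_of_forall_open hcon)
    refine hxw.trans ?_
    rw [hw.eq_iSup]
    refine iSup_le fun a => ?_
    have ha : (a : A) ∈ J := by
      by_contra ha
      exact hjw ((iInf_le_of_le ⟨a, ha⟩ le_rfl).trans a.2)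
    exact le_iSup_of_le ⟨a, ha⟩ le_rfl
  intro S hS
  by_contra! hne
  refine he.not_iInf_compl_le_iSup_of_isPrime hJ (hS.le.trans (sSup_le fun x hx => ?_))
  exact le_iSup_of_not_le fun hjx => hne x hx (hjx.antisymm (hS ▸ le_sSup hx))

omit he in
theorem isPFilter_setOf_le_map (k : C) : Order.IsPFilter {a | k ≤ e a} :=
  .of_def ⟨⊤, by simp⟩
    (fun a ha b hb => ⟨a ⊓ b, by simpa using ⟨ha, hb⟩, inf_le_left, inf_le_right⟩)
    fun {_ _} hab ha => le_trans ha (OrderHomClass.mono e hab)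

omit he in
theorem isIdeal_setOf_map_le (w : C) : Order.IsIdeal {a | e a ≤ w} where
  IsLowerSet _ _ hab ha := (OrderHomClass.mono e hab).trans ha
  Nonempty := ⟨⊥, by simp⟩
  Directed a ha b hb := ⟨a ⊔ b, by simpa using ⟨ha, hb⟩, le_sup_left, le_sup_right⟩

theorem exists_isCJI {k w : C} (hk : IsClosedElem e k) (hw : IsOpenElem e w) (h : ¬ k ≤ w) :
    ∃ j, IsCJI j ∧ j ≤ k ∧ ¬ j ≤ w := by
  obtain ⟨J, hJ, hwJ, hkJ⟩ := DistribLattice.prime_ideal_of_disjoint_filter_ideal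
    (F := (isPFilter_setOf_le_map k).toPFilter) (I := (isIdeal_setOf_map_le w).toIdeal)
    (Set.disjoint_left.2 fun a ha hb => h (le_trans (b := e a) ha hb))
  refine ⟨_, he.isCJI_iInf_compl hJ, ?_, fun hjw =>
    he.not_iInf_compl_le_iSup_of_isPrime hJ (hjw.trans ?_)⟩
  · rw [hk.eq_iInf]
    exact le_iInf fun a => iInf_le_of_le ⟨a, Set.disjoint_left.1 hkJ a.2⟩ le_rfl
  · rw [hw.eq_iSup]
    exact iSup_le fun a => le_iSup_of_le ⟨a, hwJ a.2⟩ le_rfl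

theorem le_of_forall_isCJI {c d : C} (h : ∀ j, IsCJI j → j ≤ c → j ≤ d) : c ≤ d := by
  refine he.le_of_forall_closed fun k hk hkc => he.le_of_forall_open fun w hw hdw => ?_
  by_contra hkw
  obtain ⟨j, hj, hjk, hjw⟩ := he.exists_isCJI hk hw hkw
  exact hjw ((h j hj (hjk.trans hkc)).trans hdw)

theorem le_of_forall_isCMI {c d : C} (h : ∀ m, IsCMI m → d ≤ m → c ≤ m) : c ≤ d :=
  he.dual.le_of_forall_isCJI h

theorem eq_sSup_isCJI (c : C) : c = sSup {j | IsCJI j ∧ j ≤ c} :=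
  le_antisymm (he.le_of_forall_isCJI fun _ hj hjc => le_sSup ⟨hj, hjc⟩)
    (sSup_le fun _ hj => hj.2)

theorem eq_sInf_isCMI (c : C) : c = sInf {m | IsCMI m ∧ c ≤ m} :=
  he.dual.eq_sSup_isCJI c

theorem isClosedElem_of_isCJI {j : C} (hj : IsCJI j) : IsClosedElem e j := by
  obtain ⟨K, hK, h⟩ := he.dense_join j
  obtain ⟨k, hk, rfl⟩ := hj K h
  exact hK _ hk

theorem isOpenElem_of_isCMI {m : C} (hm : IsCMI m) : IsOpenElem e m :=
  he.dual.isClosedElem_of_isCJI hm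

/-! ### The modal operations -/

theorem sInf_interval_eq_iInf {f : A → A} (hf : Monotone f) {k w : C} (hk : IsClosedElem e k)
    (hw : IsOpenElem e w) (h : k ≤ w) :
    sInf {y | ∃ a, k ≤ e a ∧ e a ≤ w ∧ y = e (f a)} = ⨅ a : {a // k ≤ e a}, e (f a) := by
  refine le_antisymm (le_iInf fun a => ?_) (le_sInf ?_)
  · obtain ⟨b, hkb, hbw⟩ := he.exists_between hk hw h
    refine le_trans (sInf_le (a := e (f (a ⊓ b))) ⟨a ⊓ b, ?_, ?_, rfl⟩)
      (OrderHomClass.mono e (hf inf_le_left))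
    · rw [map_inf]
      exact le_inf a.2 hkb
    · rw [map_inf]
      exact inf_le_right.trans hbw
  · rintro _ ⟨a, ha, -, rfl⟩
    exact iInf_le_of_le ⟨a, ha⟩ le_rfl

theorem sigmaExt_eq_iSup {f : A → A} (hf : Monotone f) (c : C) :
    sigmaExt e f c =
      ⨆ k : {k // IsClosedElem e k ∧ k ≤ c}, ⨅ a : {a // (k : C) ≤ e a}, e (f a) := by
  refine le_antisymm (sSup_le ?_) (iSup_le fun ⟨k, hk, hkc⟩ => ?_)
  · rintro _ ⟨k, w, hk, hw, hkc, hcw, rfl⟩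
    rw [he.sInf_interval_eq_iInf hf hk hw (hkc.trans hcw)]
    exact le_iSup_of_le ⟨k, hk, hkc⟩ le_rfl
  · have htop : IsOpenElem e ⊤ := map_top e ▸ isOpenElem_map ⊤
    rw [← he.sInf_interval_eq_iInf hf hk htop le_top]
    exact le_sSup ⟨k, ⊤, hk, htop, hkc, le_top, rfl⟩

theorem sigmaExt_mono {f : A → A} (hf : Monotone f) : Monotone (sigmaExt e f) := fun c d hcd => by
  rw [he.sigmaExt_eq_iSup hf, he.sigmaExt_eq_iSup hf]
  exact iSup_le fun ⟨k, hk, hkc⟩ => le_iSup_of_le ⟨k, hk, hkc.trans hcd⟩ le_rfl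

theorem sigmaExt_eq_iInf {f : A → A} (hf : Monotone f) {k : C} (hk : IsClosedElem e k) :
    sigmaExt e f k = ⨅ a : {a // k ≤ e a}, e (f a) := by
  rw [he.sigmaExt_eq_iSup hf]
  refine le_antisymm (iSup_le fun ⟨l, _, hlk⟩ => le_iInf fun a => ?_)
    (le_iSup_of_le ⟨k, hk, le_rfl⟩ le_rfl)
  exact iInf_le_of_le ⟨a, hlk.trans a.2⟩ le_rfl

theorem sigmaExt_map {f : A → A} (hf : Monotone f) (a : A) : sigmaExt e f (e a) = e (f a) := by
  rw [he.sigmaExt_eq_iInf hf (isClosedElem_map a)]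
  exact le_antisymm (iInf_le_of_le ⟨a, le_rfl⟩ le_rfl)
    (le_iInf fun b => he.map_le_map.2 (hf (he.map_le_map.1 b.2)))

theorem exists_map_le_of_sigmaExt_le {f : A → A} (hf : Monotone f) {k w : C}
    (hk : IsClosedElem e k) (hw : IsOpenElem e w) (h : sigmaExt e f k ≤ w) :
    ∃ a, k ≤ e a ∧ e (f a) ≤ w := by
  rw [he.sigmaExt_eq_iInf hf hk] at h
  obtain ⟨a, ha⟩ := he.exists_map_le (hf.comp (Subtype.mono_coe _)).directed_ge hw h
  exact ⟨a, a.2, ha⟩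

theorem sigmaExt_sSup {f : A → A} (hbot : f ⊥ = ⊥) (hsup : ∀ a b, f (a ⊔ b) = f a ⊔ f b)
    (S : Set C) : sigmaExt e f (sSup S) = sSup (sigmaExt e f '' S) := by
  have hf : Monotone f := fun a b hab => by
    rw [← sup_eq_right.2 hab, hsup]
    exact le_sup_left
  refine le_antisymm (he.le_of_forall_open fun w hw hSw => ?_) (sSup_le ?_)
  · rw [he.sigmaExt_eq_iSup hf]
    refine iSup_le fun ⟨k, hk, hkS⟩ => ?_
    have hcov : k ≤ ⨆ a : {a // e (f a) ≤ w}, e a := he.le_of_forall_isCJI fun j hj hjk => by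
      obtain ⟨x, hx, hjx⟩ := hj.exists_le (hjk.trans hkS)
      obtain ⟨a, hja, haw⟩ := he.exists_map_le_of_sigmaExt_le hf (he.isClosedElem_of_isCJI hj) hw
        ((he.sigmaExt_mono hf hjx).trans ((le_sSup (Set.mem_image_of_mem _ hx)).trans hSw))
      exact le_iSup_of_le ⟨a, haw⟩ hja
    have : Nonempty {a // e (f a) ≤ w} := ⟨⟨⊥, by simp [hbot]⟩⟩
    have hdir : Directed (· ≤ ·) fun a : {a // e (f a) ≤ w} => (a : A) := fun a b =>
      ⟨⟨a ⊔ b, by rw [hsup, map_sup]; exact sup_le a.2 b.2⟩, le_sup_left, le_sup_right⟩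
    obtain ⟨a, hka⟩ := he.exists_le_map hdir hk hcov
    exact iInf_le_of_le ⟨a, hka⟩ a.2
  · rintro _ ⟨x, hx, rfl⟩
    exact he.sigmaExt_mono hf (le_sSup hx)

end IsCanonicalExtension

open ModalBiheytingAlgebra

theorem dia_mono : Monotone (dia : A → A) := fun a b hab => by
  rw [← sup_eq_right.2 hab, dia_sup]
  exact le_sup_left

theorem box_mono : Monotone (box : A → A) := fun _ _ hab =>
  dia_mono (A := Aᵒᵈ) hab

namespace IsCanonicalExtension

variable (he : IsCanonicalExtension e)
include he

theorem diaC_mono : Monotone (diaC e) := he.sigmaExt_mono dia_mono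

theorem diaC_map (a : A) : diaC e (e a) = e (dia a) := he.sigmaExt_map dia_mono a

theorem diaC_sSup (S : Set C) : diaC e (sSup S) = sSup (diaC e '' S) :=
  he.sigmaExt_sSup dia_bot dia_sup S

theorem boxC_mono : Monotone (boxC e) := fun c d hcd => by
  rw [boxC_eq_diaC_dual, boxC_eq_diaC_dual]
  exact he.dual.diaC_mono hcd

theorem boxC_map (a : A) : boxC e (e a) = e (box a) := by
  rw [boxC_eq_diaC_dual]
  exact he.dual.diaC_map a

theorem boxC_sInf (S : Set C) : boxC e (sInf S) = sInf (boxC e '' S) := by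
  rw [funext (boxC_eq_diaC_dual (e := e))]
  exact he.dual.diaC_sSup S

theorem gc_diaC_bboxC : GaloisConnection (diaC e) (bboxC e) := fun a b => by
  refine ⟨fun h => le_sSup h, fun h => (he.diaC_mono h).trans ?_⟩
  rw [bboxC, he.diaC_sSup]
  exact sSup_le (by rintro _ ⟨x, hx, rfl⟩; exact hx)

theorem gc_bdiaC_boxC : GaloisConnection (bdiaC e) (boxC e) := fun a b => by
  rw [boxC_eq_diaC_dual, bdiaC_eq_bboxC_dual]
  exact (he.dual.gc_diaC_bboxC b a).symm

theorem isClosedElem_diaC {k : C} (hk : IsClosedElem e k) : IsClosedElem e (diaC e k) := by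
  rw [diaC, he.sigmaExt_eq_iInf dia_mono hk]
  exact isClosedElem_iInf_map _

theorem exists_map_dia_le {k w : C} (hk : IsClosedElem e k) (hw : IsOpenElem e w)
    (h : diaC e k ≤ w) : ∃ a, k ≤ e a ∧ e (dia a) ≤ w :=
  he.exists_map_le_of_sigmaExt_le dia_mono hk hw h

theorem exists_le_map_box {w k : C} (hw : IsOpenElem e w) (hk : IsClosedElem e k)
    (h : k ≤ boxC e w) : ∃ a, e a ≤ w ∧ k ≤ e (box a) := by
  rw [boxC_eq_diaC_dual] at h
  exact he.dual.exists_map_dia_le hw hk h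

theorem boxC_eq_iInf {k : C} (hk : IsClosedElem e k) :
    boxC e k = ⨅ a : {a // k ≤ e a}, e (box a) := by
  conv_lhs => rw [hk.eq_iInf, iInf, he.boxC_sInf, ← Set.range_comp]
  exact iInf_congr fun a => he.boxC_map a

theorem isClosedElem_boxC {k : C} (hk : IsClosedElem e k) : IsClosedElem e (boxC e k) := by
  rw [he.boxC_eq_iInf hk]
  exact isClosedElem_iInf_map _

theorem exists_map_box_le {k w : C} (hk : IsClosedElem e k) (hw : IsOpenElem e w)
    (h : boxC e k ≤ w) : ∃ a, k ≤ e a ∧ e (box a) ≤ w := by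
  rw [he.boxC_eq_iInf hk] at h
  obtain ⟨a, ha⟩ := he.exists_map_le (box_mono.comp (Subtype.mono_coe _)).directed_ge hw h
  exact ⟨a, a.2, ha⟩

theorem isClosedElem_bdiaC {k : C} (hk : IsClosedElem e k) : IsClosedElem e (bdiaC e k) := by
  refine he.isClosedElem_of_forall_open fun w hw h => ?_
  obtain ⟨a, haw, hka⟩ := he.exists_le_map_box hw hk (he.gc_bdiaC_boxC.le_iff_le.1 h)
  exact ⟨a, he.gc_bdiaC_boxC.le_iff_le.2 (he.boxC_map a ▸ hka), haw⟩

end IsCanonicalExtension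

end CanonicalExtension

/-! ### Approximation of closed and open elements -/

section Approximation

variable {A : Type u} [ModalBiheytingAlgebra A] {C : Type v} [CompletelyDistribLattice C]
  {e : BoundedLatticeHom A C}

/-- The least fixed point relative to `A`: the meet of the prefixed points of `g` that belong to
`A`. It is the value of `μ* X. t(X)` when `g` is the term function of `t`. -/
def lfpStar (e : BoundedLatticeHom A C) (g : C → C) : C :=
  sInf {c | ∃ a : A, c = e a ∧ g (e a) ≤ e a}

/-- The greatest fixed point relative to `A`, which interprets `ν*`. -/
def gfpStar (e : BoundedLatticeHom A C) (g : C → C) : C :=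
  sSup {c | ∃ a : A, c = e a ∧ e a ≤ g (e a)}

theorem lfpStar_eq_sInf_image (g : C → C) : lfpStar e g = sInf (e '' {a | g (e a) ≤ e a}) :=
  congrArg sInf (Set.ext fun _ => exists_congr fun _ => by rw [and_comm, eq_comm]; rfl)

theorem isClosedElem_lfpStar (g : C → C) : IsClosedElem e (lfpStar e g) :=
  ⟨_, lfpStar_eq_sInf_image g⟩

theorem lfpStar_le {g : C → C} {a : A} (h : g (e a) ≤ e a) : lfpStar e g ≤ e a :=
  sInf_le ⟨a, rfl, h⟩

theorem lfpStar_mono {g h : C → C} (hgh : ∀ a, g (e a) ≤ h (e a)) : lfpStar e g ≤ lfpStar e h :=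
  le_sInf (by rintro _ ⟨a, rfl, ha⟩; exact lfpStar_le ((hgh a).trans ha))

theorem gfpStar_mono {g h : C → C} (hgh : ∀ a, g (e a) ≤ h (e a)) : gfpStar e g ≤ gfpStar e h :=
  lfpStar_mono (A := Aᵒᵈ) (C := Cᵒᵈ) (e := BoundedLatticeHom.dual e) (g := h) (h := g) hgh

/-- `F` converges along `l` to the closed element `k` from above, as far as elements of `A` can
tell: every upper bound of `k` in `A` is eventually an upper bound of `F`. -/
def ClosedApprox {ι : Type*} (e : BoundedLatticeHom A C) (l : Filter ι) (F : ι → C) (k : C) :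
    Prop :=
  IsClosedElem e k ∧ ∀ b, k ≤ e b → ∀ᶠ i in l, F i ≤ e b

/-- The order dual of `ClosedApprox`: `F` converges along `l` to the open element `w` from
below. -/
def OpenApprox {ι : Type*} (e : BoundedLatticeHom A C) (l : Filter ι) (F : ι → C) (w : C) :
    Prop :=
  IsOpenElem e w ∧ ∀ b, e b ≤ w → ∀ᶠ i in l, e b ≤ F i

variable {ι : Type*} {l : Filter ι} {F G : ι → C} {k k' w w' : C}

theorem closedApprox_const (hk : IsClosedElem e k) : ClosedApprox e l (fun _ => k) k :=
  ⟨hk, fun _ hb => Filter.Eventually.of_forall fun _ => hb⟩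

theorem openApprox_const (hw : IsOpenElem e w) : OpenApprox e l (fun _ => w) w :=
  ⟨hw, fun _ hb => Filter.Eventually.of_forall fun _ => hb⟩

theorem closedApprox_atBot (hk : IsClosedElem e k) :
    ClosedApprox e Filter.atBot (fun a : {a // k ≤ e a} => e a) k :=
  ⟨hk, fun b hb => (Filter.eventually_le_atBot (⟨b, hb⟩ : {a // k ≤ e a})).mono
    fun _ ha => OrderHomClass.mono e ha⟩

theorem openApprox_atTop (hw : IsOpenElem e w) :
    OpenApprox e Filter.atTop (fun a : {a // e a ≤ w} => e a) w :=
  ⟨hw, fun b hb => (Filter.eventually_ge_atTop (⟨b, hb⟩ : {a // e a ≤ w})).mono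
    fun _ ha => OrderHomClass.mono e ha⟩

theorem ClosedApprox.sup (hF : ClosedApprox e l F k) (hG : ClosedApprox e l G k') :
    ClosedApprox e l (fun i => F i ⊔ G i) (k ⊔ k') :=
  ⟨hF.1.sup hG.1, fun b hb => ((hF.2 b (le_sup_left.trans hb)).and
    (hG.2 b (le_sup_right.trans hb))).mono fun _ h => sup_le h.1 h.2⟩

namespace IsCanonicalExtension

variable (he : IsCanonicalExtension e)
include he

theorem eventually_le (hF : ClosedApprox e l F k) (hG : OpenApprox e l G w) (h : k ≤ w) :
    ∀ᶠ i in l, F i ≤ G i := by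
  obtain ⟨b, hkb, hbw⟩ := he.exists_between hF.1 hG.1 h
  filter_upwards [hF.2 b hkb, hG.2 b hbw] with i hi hi'
  exact hi.trans hi'

theorem closedApprox_inf (hF : ClosedApprox e l F k) (hG : ClosedApprox e l G k') :
    ClosedApprox e l (fun i => F i ⊓ G i) (k ⊓ k') := by
  refine ⟨hF.1.inf hG.1, fun b hb => ?_⟩
  obtain ⟨a, a', ha, ha', hab⟩ := he.exists_map_inf_le hF.1 hG.1 (isOpenElem_map b) hb
  rw [map_inf] at hab
  filter_upwards [hF.2 a ha, hG.2 a' ha'] with i hi hi'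
  exact (inf_le_inf hi hi').trans hab

theorem closedApprox_himp (hF : OpenApprox e l F w) (hG : ClosedApprox e l G k) :
    ClosedApprox e l (fun i => F i ⇨ G i) (w ⇨ k) := by
  refine ⟨he.isClosedElem_himp hF.1 hG.1, fun b hb => ?_⟩
  obtain ⟨a, a', ha, ha', hab⟩ := he.exists_map_himp_le hF.1 hG.1 (isOpenElem_map b) hb
  filter_upwards [hF.2 a ha, hG.2 a' ha'] with i hi hi'
  exact (himp_le_himp hi hi').trans (he.map_himp a a' ▸ hab)

theorem closedApprox_sdiff (hF : ClosedApprox e l F k) (hG : OpenApprox e l G w) :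
    ClosedApprox e l (fun i => F i \ G i) (k \ w) := by
  refine ⟨he.isClosedElem_sdiff hF.1 hG.1, fun b hb => ?_⟩
  obtain ⟨a, a', ha, ha', hab⟩ := he.exists_map_sdiff_le hF.1 hG.1 (isOpenElem_map b) hb
  filter_upwards [hF.2 a ha, hG.2 a' ha'] with i hi hi'
  exact (sdiff_le_sdiff hi hi').trans (he.map_sdiff a a' ▸ hab)

theorem closedApprox_diaC (hF : ClosedApprox e l F k) :
    ClosedApprox e l (fun i => diaC e (F i)) (diaC e k) := by
  refine ⟨he.isClosedElem_diaC hF.1, fun b hb => ?_⟩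
  obtain ⟨a, ha, hab⟩ := he.exists_map_dia_le hF.1 (isOpenElem_map b) hb
  filter_upwards [hF.2 a ha] with i hi
  exact (he.diaC_mono hi).trans (he.diaC_map a ▸ hab)

theorem closedApprox_boxC (hF : ClosedApprox e l F k) :
    ClosedApprox e l (fun i => boxC e (F i)) (boxC e k) := by
  refine ⟨he.isClosedElem_boxC hF.1, fun b hb => ?_⟩
  obtain ⟨a, ha, hab⟩ := he.exists_map_box_le hF.1 (isOpenElem_map b) hb
  filter_upwards [hF.2 a ha] with i hi
  exact (he.boxC_mono hi).trans (he.boxC_map a ▸ hab)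

theorem closedApprox_bdiaC (hF : ClosedApprox e l F k) :
    ClosedApprox e l (fun i => bdiaC e (F i)) (bdiaC e k) := by
  refine ⟨he.isClosedElem_bdiaC hF.1, fun b hb => ?_⟩
  obtain ⟨a, hab, ha⟩ := he.exists_le_map_box (isOpenElem_map b) hF.1
    (he.gc_bdiaC_boxC.le_iff_le.1 hb)
  filter_upwards [hF.2 _ ha] with i hi
  exact (he.gc_bdiaC_boxC.le_iff_le.2 (he.boxC_map a ▸ hi)).trans hab

theorem closedApprox_lfpStar {f : ι → C → C} {g : C → C}
    (h : ∀ a, ClosedApprox e l (fun i => f i (e a)) (g (e a))) :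
    ClosedApprox e l (fun i => lfpStar e (f i)) (lfpStar e g) := by
  refine ⟨isClosedElem_lfpStar g, fun b hb => ?_⟩
  rw [lfpStar_eq_sInf_image] at hb
  obtain ⟨S, hS, hSb⟩ := he.exists_finset_le (isOpenElem_map b) hb
  filter_upwards [S.eventually_all.2 fun a ha => (h a).2 a (hS ha)] with i hi
  refine le_trans ?_ hSb
  rw [map_finset_inf]
  exact Finset.le_inf fun a ha => lfpStar_le (hi a ha)

theorem openApprox_gfpStar {f : ι → C → C} {g : C → C}
    (h : ∀ a, OpenApprox e l (fun i => f i (e a)) (g (e a))) :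
    OpenApprox e l (fun i => gfpStar e (f i)) (gfpStar e g) :=
  he.dual.closedApprox_lfpStar h

theorem openApprox_diaC (hF : OpenApprox e l F w) :
    OpenApprox e l (fun i => diaC e (F i)) (diaC e w) := by
  simp only [diaC_eq_boxC_dual]
  exact he.dual.closedApprox_boxC hF

theorem openApprox_boxC (hF : OpenApprox e l F w) :
    OpenApprox e l (fun i => boxC e (F i)) (boxC e w) := by
  simp only [boxC_eq_diaC_dual]
  exact he.dual.closedApprox_diaC hF

theorem openApprox_bboxC (hF : OpenApprox e l F w) :
    OpenApprox e l (fun i => bboxC e (F i)) (bboxC e w) := by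
  simp only [bboxC_eq_bdiaC_dual]
  exact he.dual.closedApprox_bdiaC hF

end IsCanonicalExtension

end Approximation

/-! ### Assignments and substitution -/

/-- Membership of `C` in the set of values allowed for `j^ε` under admissible assignments: the
completely join-irreducible elements of `C^ε`. -/
def OType.IsIrr {C : Type v} [CompleteLattice C] : OType → C → Prop
  | one => IsCJI
  | dual => IsCMI

/-- The nominals of a formula for `ε = 1`, its co-nominals for `ε = ∂`. -/
def XTerm.names {n : ℕ} (t : XTerm n) : OType → Set ℕ
  | .one => t.noms
  | .dual => t.conoms

/-- The assignment `V` with the value of the propositional variable `p` changed to `c`. -/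
def Valuation.setProp {C : Type v} (V : Valuation C) (p : ℕ) (c : C) : Valuation C :=
  { V with prop := Function.update V.prop p c }

/-- The assignment `V` with the value of `j^ε` changed to `c`, where `j^ε` is the nominal `y` if
`ε = 1` and the co-nominal `y` if `ε = ∂`. -/
def Valuation.setName {C : Type v} (V : Valuation C) : OType → ℕ → C → Valuation C
  | .one, y, c => { V with nom := Function.update V.nom y c }
  | .dual, y, c => { V with conom := Function.update V.conom y c }

section Semantics

variable {A : Type u} [ModalBiheytingAlgebra A] {C : Type v} [CompletelyDistribLattice C]
  {e : BoundedLatticeHom A C} {V W : Valuation C}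

theorem Valuation.IsAdmissible.setProp (hV : V.IsAdmissible e) (p : ℕ) (a : A) :
    (V.setProp p (e a)).IsAdmissible e where
  nom := hV.nom
  conom := hV.conom
  prop := (Function.forall_update_iff V.prop fun _ x => x ∈ Set.range e).2
    ⟨⟨a, rfl⟩, fun q _ => hV.prop q⟩

theorem Valuation.IsAdmissible.setName (hV : V.IsAdmissible e) {ε : OType} (y : ℕ) {x : C}
    (hx : ε.IsIrr x) : (V.setName ε y x).IsAdmissible e := by
  cases ε with
  | one =>
    exact ⟨(Function.forall_update_iff V.nom fun _ => IsCJI).2 ⟨hx, fun i _ => hV.nom i⟩,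
      hV.conom, hV.prop⟩
  | dual =>
    exact ⟨hV.nom,
      (Function.forall_update_iff V.conom fun _ => IsCMI).2 ⟨hx, fun m _ => hV.conom m⟩, hV.prop⟩

namespace XTerm

variable {n k : ℕ}

theorem eval_mu (t : XTerm (n + 1)) (ρ : Fin n → C) :
    t.mu.eval e V ρ = lfpStar e fun c => t.eval e V (Fin.cons c ρ) :=
  rfl

theorem eval_nu (t : XTerm (n + 1)) (ρ : Fin n → C) :
    t.nu.eval e V ρ = gfpStar e fun c => t.eval e V (Fin.cons c ρ) :=
  rfl

theorem eval_congr (t : XTerm n) (hp : Set.EqOn V.prop W.prop t.props)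
    (hi : Set.EqOn V.nom W.nom t.noms) (hm : Set.EqOn V.conom W.conom t.conoms) (ρ : Fin n → C) :
    t.eval e V ρ = t.eval e W ρ := by
  induction t with
  | bot | top | fvar _ => rfl
  | prop p => exact hp rfl
  | nom i => exact hi rfl
  | conom m => exact hm rfl
  | conj _ _ ihs iht | disj _ _ ihs iht | imp _ _ ihs iht | sub _ _ ihs iht =>
    simp only [eval, ihs (hp.mono Set.subset_union_left) (hi.mono Set.subset_union_left)
        (hm.mono Set.subset_union_left),
      iht (hp.mono Set.subset_union_right) (hi.mono Set.subset_union_right)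
        (hm.mono Set.subset_union_right)]
  | dia _ ih | box _ ih | bbox _ ih | bdia _ ih | mu _ ih | nu _ ih =>
    simp only [eval, ih hp hi hm]

theorem eval_setProp {t : XTerm n} {p : ℕ} (h : p ∉ t.props) (c : C) (ρ : Fin n → C) :
    t.eval e (V.setProp p c) ρ = t.eval e V ρ :=
  eval_congr (V := V.setProp p c) (W := V) t
    (fun _ hq => Function.update_of_ne (ne_of_mem_of_not_mem hq h) _ _)
    (fun _ _ => rfl) (fun _ _ => rfl) ρ

theorem eval_prop_setProp (p : ℕ) (c : C) (ρ : Fin n → C) :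
    (prop p : XTerm n).eval e (V.setProp p c) ρ = c :=
  Function.update_self ..

theorem eval_setName {t : XTerm n} {ε : OType} {y : ℕ} (h : y ∉ t.names ε)
    (c : C) (ρ : Fin n → C) :
    t.eval e (V.setName ε y c) ρ = t.eval e V ρ := by
  cases ε with
  | one =>
    exact eval_congr (V := V.setName .one y c) (W := V) t (fun _ _ => rfl)
      (fun _ hj => Function.update_of_ne (ne_of_mem_of_not_mem hj h) _ _)
      (fun _ _ => rfl) ρ
  | dual =>
    exact eval_congr (V := V.setName .dual y c) (W := V) t (fun _ _ => rfl) (fun _ _ => rfl)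
      (fun _ hj => Function.update_of_ne (ne_of_mem_of_not_mem hj h) _ _) ρ

theorem eval_rename (t : XTerm n) (f : Fin n → Fin k) (ρ : Fin k → C) :
    (t.rename f).eval e V ρ = t.eval e V (ρ ∘ f) := by
  have cons_comp {n k : ℕ} (f : Fin n → Fin k) (ρ : Fin k → C) (c : C) :
      (Fin.cons c ρ : Fin (k + 1) → C) ∘ (Fin.cons 0 fun l => (f l).succ : Fin (n + 1) → _) =
        Fin.cons c (ρ ∘ f) :=
    Fin.comp_cons _ _ _
  induction t generalizing k with
  | bot | top | prop _ | nom _ | conom _ | fvar _ => rfl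
  | conj _ _ ihs iht | disj _ _ ihs iht | imp _ _ ihs iht | sub _ _ ihs iht =>
    simp only [rename, eval, ihs, iht]
  | dia _ ih | box _ ih | bbox _ ih | bdia _ ih => simp only [rename, eval, ih]
  | mu _ ih | nu _ ih => simp only [rename, eval, ih, cons_comp]

theorem eval_subst (t : XTerm n) (f : Fin n → XTerm k) (ρ : Fin k → C) :
    (t.subst f).eval e V ρ = t.eval e V fun l => (f l).eval e V ρ := by
  have eval_cons {n k : ℕ} (f : Fin n → XTerm k) (ρ : Fin k → C) (c : C) :
      (fun l => ((Fin.cons (fvar 0) fun l => (f l).rename Fin.succ :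
        Fin (n + 1) → XTerm (k + 1)) l).eval e V (Fin.cons c ρ)) =
      Fin.cons c fun l => (f l).eval e V ρ := by
    refine funext fun l => Fin.cases rfl (fun l => ?_) l
    simp only [Fin.cons_succ, eval_rename]
    rfl
  induction t generalizing k with
  | bot | top | prop _ | nom _ | conom _ | fvar _ => rfl
  | conj _ _ ihs iht | disj _ _ ihs iht | imp _ _ ihs iht | sub _ _ ihs iht =>
    simp only [subst, eval, ihs, iht]
  | dia _ ih | box _ ih | bbox _ ih | bdia _ ih => simp only [subst, eval, ih]
  | mu _ ih | nu _ ih => simp only [subst, eval, ih, eval_cons]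

theorem eval_substProp (t : XTerm n) (p : ℕ) (α : XTerm 0) (ρ : Fin n → C) :
    (t.substProp p α).eval e V ρ = t.eval e (V.setProp p (α.eval e V Fin.elim0)) ρ := by
  induction t with
  | prop q =>
    by_cases h : q = p
    · subst h
      simp only [substProp, if_true, eval_rename, eval, Valuation.setProp, Function.update_self]
      exact congrArg _ (Subsingleton.elim _ _)
    · simp only [substProp, h, if_false, eval, Valuation.setProp, Function.update_of_ne, ne_eq,
        not_false_eq_true]
  | bot | top | nom _ | conom _ | fvar _ => rfl
  | conj _ _ ihs iht | disj _ _ ihs iht | imp _ _ ihs iht | sub _ _ ihs iht =>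
    simp only [substProp, eval, ihs, iht]
  | dia _ ih | box _ ih | bbox _ ih | bdia _ ih | mu _ ih | nu _ ih =>
    simp only [substProp, eval, ih]

theorem eval_bigDisj_le {αs : List (XTerm 0)} {c : C} :
    (bigDisj αs).eval e V Fin.elim0 ≤ c ↔ ∀ α ∈ αs, α.eval e V Fin.elim0 ≤ c := by
  induction αs using bigDisj.induct with
  | case1 => simp [bigDisj, eval]
  | case2 => simp [bigDisj]
  | case3 α β αs ih => simp only [bigDisj, eval, sup_le_iff, ih, List.forall_mem_cons]

theorem le_eval_bigConj {αs : List (XTerm 0)} {c : C} :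
    c ≤ (bigConj αs).eval e V Fin.elim0 ↔ ∀ α ∈ αs, c ≤ α.eval e V Fin.elim0 := by
  induction αs using bigConj.induct with
  | case1 => simp [bigConj, eval]
  | case2 => simp [bigConj]
  | case3 α β αs ih => simp only [bigConj, eval, le_inf_iff, ih, List.forall_mem_cons]

theorem synClosed_bigDisj {αs : List (XTerm 0)} (h : ∀ α ∈ αs, α.SynClosed) :
    (bigDisj αs).SynClosed := by
  induction αs using bigDisj.induct with
  | case1 => trivial
  | case2 α => exact h α List.mem_cons_self
  | case3 α β αs ih =>
    rw [List.forall_mem_cons] at h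
    exact ⟨h.1, ih h.2⟩

theorem synOpen_bigConj {αs : List (XTerm 0)} (h : ∀ α ∈ αs, α.SynOpen) :
    (bigConj αs).SynOpen := by
  induction αs using bigConj.induct with
  | case1 => trivial
  | case2 α => exact h α List.mem_cons_self
  | case3 α β αs ih =>
    rw [List.forall_mem_cons] at h
    exact ⟨h.1, ih h.2⟩

end XTerm

namespace Term

variable {n : ℕ}

theorem noms_star (t : Term n) : t.star.noms = ∅ := by
  induction t with
  | bot | top | prop _ | fvar _ => rfl
  | conj _ _ ihs iht | disj _ _ ihs iht | imp _ _ ihs iht | sub _ _ ihs iht =>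
    simp only [star, XTerm.noms, ihs, iht, Set.union_empty]
  | dia _ ih | box _ ih | mu _ ih | nu _ ih => exact ih

theorem conoms_star (t : Term n) : t.star.conoms = ∅ := by
  induction t with
  | bot | top | prop _ | fvar _ => rfl
  | conj _ _ ihs iht | disj _ _ ihs iht | imp _ _ ihs iht | sub _ _ ihs iht =>
    simp only [star, XTerm.conoms, ihs, iht, Set.union_empty]
  | dia _ ih | box _ ih | mu _ ih | nu _ ih => exact ih

theorem names_star (t : Term n) (ε : OType) : t.star.names ε = ∅ := by
  cases ε with
  | one => exact t.noms_star
  | dual => exact t.conoms_star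

theorem eval_star_setName (t : Term n) (V : Valuation C) (ε : OType) (y : ℕ) (c : C)
    (ρ : Fin n → C) : t.star.eval e (V.setName ε y c) ρ = t.star.eval e V ρ :=
  XTerm.eval_setName (by simp [names_star]) c ρ

end Term

/-! ### Monotonicity -/

/-- The order of `C` if `s = true`, and the reverse order if `s = false`: arguments related in this
way yield related values at positions signed `s`. -/
def SignedLE {C : Type v} [LE C] : Bool → C → C → Prop
  | true, x, y => x ≤ y
  | false, x, y => y ≤ x

theorem signedLE_not {C : Type v} [LE C] {s : Bool} {x y : C} :
    SignedLE (!s) x y ↔ SignedLE s y x := by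
  cases s <;> rfl

theorem XTerm.eval_mono_prop (he : IsCanonicalExtension e) {n : ℕ} {t : XTerm n} {p : ℕ} {s : Bool}
    (ht : t.SignedProp s p) {x y : C} (hxy : SignedLE s x y) (ρ : Fin n → C) :
    t.eval e (V.setProp p x) ρ ≤ t.eval e (V.setProp p y) ρ := by
  induction t generalizing s x y with
  | bot | top | nom _ | conom _ | fvar _ => exact le_rfl
  | prop q =>
    by_cases h : q = p
    · obtain rfl := ht h
      subst h
      simpa only [eval, Valuation.setProp, Function.update_self] using! hxy
    · simp only [eval, Valuation.setProp, Function.update_of_ne h, le_refl]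
  | conj _ _ ihs iht => exact inf_le_inf (ihs ht.1 hxy ρ) (iht ht.2 hxy ρ)
  | disj _ _ ihs iht => exact sup_le_sup (ihs ht.1 hxy ρ) (iht ht.2 hxy ρ)
  | imp _ _ ihs iht => exact himp_le_himp (ihs ht.1 (signedLE_not.2 hxy) ρ) (iht ht.2 hxy ρ)
  | sub _ _ ihs iht => exact sdiff_le_sdiff (ihs ht.1 hxy ρ) (iht ht.2 (signedLE_not.2 hxy) ρ)
  | dia _ ih => exact he.diaC_mono (ih ht hxy ρ)
  | box _ ih => exact he.boxC_mono (ih ht hxy ρ)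
  | bbox _ ih => exact he.gc_diaC_bboxC.monotone_u (ih ht hxy ρ)
  | bdia _ ih => exact he.gc_bdiaC_boxC.monotone_l (ih ht hxy ρ)
  | mu _ ih =>
    simp only [eval_mu]
    exact lfpStar_mono fun _ => ih ht hxy _
  | nu _ ih =>
    simp only [eval_nu]
    exact gfpStar_mono fun _ => ih ht hxy _

theorem Term.eval_star_mono (he : IsCanonicalExtension e) {n : ℕ} {t : Term n} {z : Fin n}
    {s : Bool} (ht : t.SignedVar s z) {x y : C} (hxy : SignedLE s x y) (ρ : Fin n → C) :
    t.star.eval e V (Function.update ρ z x) ≤ t.star.eval e V (Function.update ρ z y) := by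
  induction t generalizing s x y with
  | bot | top | prop _ => exact le_rfl
  | fvar z' =>
    by_cases h : z' = z
    · obtain rfl := ht h
      subst h
      simpa only [star, XTerm.eval, Function.update_self] using! hxy
    · simp only [star, XTerm.eval, Function.update_of_ne h, le_refl]
  | conj _ _ ihs iht => exact inf_le_inf (ihs ht.1 hxy ρ) (iht ht.2 hxy ρ)
  | disj _ _ ihs iht => exact sup_le_sup (ihs ht.1 hxy ρ) (iht ht.2 hxy ρ)
  | imp _ _ ihs iht => exact himp_le_himp (ihs ht.1 (signedLE_not.2 hxy) ρ) (iht ht.2 hxy ρ)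
  | sub _ _ ihs iht => exact sdiff_le_sdiff (ihs ht.1 hxy ρ) (iht ht.2 (signedLE_not.2 hxy) ρ)
  | dia _ ih => exact he.diaC_mono (ih ht hxy ρ)
  | box _ ih => exact he.boxC_mono (ih ht hxy ρ)
  | mu _ ih =>
    simp only [star, XTerm.eval_mu, Fin.cons_update]
    exact lfpStar_mono fun _ => ih ht hxy _
  | nu _ ih =>
    simp only [star, XTerm.eval_nu, Fin.cons_update]
    exact gfpStar_mono fun _ => ih ht hxy _

theorem Term.monotone_eval_star_cons (he : IsCanonicalExtension e) {n : ℕ} {t : Term (n + 1)}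
    (ht : t.SignedVar true 0) (ρ : Fin n → C) :
    Monotone fun c : C => t.star.eval e V (Fin.cons c ρ) := fun x y hxy => by
  simpa only [Fin.update_cons_zero] using eval_star_mono he ht hxy (Fin.cons x ρ)

end Semantics

/-! ### Approximation of formulas, and the Ackermann rules -/

section Ackermann

variable {A : Type u} [ModalBiheytingAlgebra A] {C : Type v} [CompletelyDistribLattice C]
  {e : BoundedLatticeHom A C} {V : Valuation C} {p : ℕ} {s : Bool}

theorem XTerm.signedProp_of_notMem {n : ℕ} {t : XTerm n} (h : p ∉ t.props) :
    t.SignedProp s p := by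
  induction t generalizing s with
  | bot | top | nom _ | conom _ | fvar _ => trivial
  | prop q => exact fun hq => absurd hq.symm h
  | conj _ _ ihs iht | disj _ _ ihs iht | imp _ _ ihs iht | sub _ _ ihs iht =>
    exact ⟨ihs fun hp => h (Or.inl hp), iht fun hp => h (Or.inr hp)⟩
  | dia _ ih | box _ ih | bbox _ ih | bdia _ ih | mu _ ih | nu _ ih => exact ih h

variable {ι : Type*} {l : Filter ι} {x : ι → C} {c : C}

theorem IsCanonicalExtension.approx_prop (hV : V.IsAdmissible e) (q : ℕ) :
    ((q = p → ClosedApprox e l x c) →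
      ClosedApprox e l (fun i => (V.setProp p (x i)).prop q) ((V.setProp p c).prop q)) ∧
    ((q = p → OpenApprox e l x c) →
      OpenApprox e l (fun i => (V.setProp p (x i)).prop q) ((V.setProp p c).prop q)) := by
  by_cases h : q = p
  · subst h
    simp only [Valuation.setProp, Function.update_self, true_imp_iff, imp_self, and_self]
  · obtain ⟨a, ha⟩ := hV.prop q
    simp only [Valuation.setProp, Function.update_of_ne h, ← ha]
    exact ⟨fun _ => closedApprox_const (isClosedElem_map a),
      fun _ => openApprox_const (isOpenElem_map a)⟩

/-- The topological Ackermann lemma. The parameters of fixed points have to range over `A` for the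
binders to be covered: `μ*` and `ν*` only test elements of `A`. -/
theorem IsCanonicalExtension.approx_eval (he : IsCanonicalExtension e) (hV : V.IsAdmissible e)
    (hclosed : s = true → ClosedApprox e l x c) (hopen : s = false → OpenApprox e l x c)
    {n : ℕ} (t : XTerm n) (ρ : Fin n → A) :
    (t.SynClosed → t.SignedProp s p → ClosedApprox e l
      (fun i => t.eval e (V.setProp p (x i)) (e ∘ ρ)) (t.eval e (V.setProp p c) (e ∘ ρ))) ∧
    (t.SynOpen → t.SignedProp (!s) p → OpenApprox e l
      (fun i => t.eval e (V.setProp p (x i)) (e ∘ ρ)) (t.eval e (V.setProp p c) (e ∘ ρ))) := by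
  induction t with
  | bot | top | fvar _ =>
    simp only [XTerm.eval, ← map_bot e, ← map_top e]
    exact ⟨fun _ _ => closedApprox_const (isClosedElem_map _),
      fun _ _ => openApprox_const (isOpenElem_map _)⟩
  | prop q =>
    exact ⟨fun _ h => (approx_prop hV q).1 fun hq => hclosed (h hq),
      fun _ h => (approx_prop hV q).2 fun hq => hopen (by simpa using h hq)⟩
  | nom i => exact ⟨fun _ _ => closedApprox_const (he.isClosedElem_of_isCJI (hV.nom i)), nofun⟩
  | conom m => exact ⟨nofun, fun _ _ => openApprox_const (he.isOpenElem_of_isCMI (hV.conom m))⟩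
  | conj t u iht ihu =>
    exact ⟨fun ho hs => he.closedApprox_inf ((iht ρ).1 ho.1 hs.1) ((ihu ρ).1 ho.2 hs.2),
      fun ho hs => ClosedApprox.sup (e := BoundedLatticeHom.dual e) ((iht ρ).2 ho.1 hs.1)
        ((ihu ρ).2 ho.2 hs.2)⟩
  | disj t u iht ihu =>
    exact ⟨fun ho hs => ((iht ρ).1 ho.1 hs.1).sup ((ihu ρ).1 ho.2 hs.2),
      fun ho hs => he.dual.closedApprox_inf ((iht ρ).2 ho.1 hs.1) ((ihu ρ).2 ho.2 hs.2)⟩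
  | imp t u iht ihu =>
    exact ⟨fun ho hs => he.closedApprox_himp ((iht ρ).2 ho.1 hs.1) ((ihu ρ).1 ho.2 hs.2),
      fun ho hs => he.dual.closedApprox_sdiff ((ihu ρ).2 ho.2 hs.2)
        ((iht ρ).1 ho.1 (Bool.not_not s ▸ hs.1))⟩
  | sub t u iht ihu =>
    exact ⟨fun ho hs => he.closedApprox_sdiff ((iht ρ).1 ho.1 hs.1) ((ihu ρ).2 ho.2 hs.2),
      fun ho hs => he.dual.closedApprox_himp ((ihu ρ).1 ho.2 (Bool.not_not s ▸ hs.2))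
        ((iht ρ).2 ho.1 hs.1)⟩
  | dia t ih =>
    exact ⟨fun ho hs => he.closedApprox_diaC ((ih ρ).1 ho hs),
      fun ho hs => he.openApprox_diaC ((ih ρ).2 ho hs)⟩
  | box t ih =>
    exact ⟨fun ho hs => he.closedApprox_boxC ((ih ρ).1 ho hs),
      fun ho hs => he.openApprox_boxC ((ih ρ).2 ho hs)⟩
  | bbox t ih => exact ⟨nofun, fun ho hs => he.openApprox_bboxC ((ih ρ).2 ho hs)⟩
  | bdia t ih => exact ⟨fun ho hs => he.closedApprox_bdiaC ((ih ρ).1 ho hs), nofun⟩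
  | mu t ih =>
    simp only [XTerm.eval_mu]
    refine ⟨fun ho hs => he.closedApprox_lfpStar fun a => ?_, nofun⟩
    simpa only [Fin.comp_cons] using (ih (Fin.cons a ρ)).1 ho hs
  | nu t ih =>
    simp only [XTerm.eval_nu]
    refine ⟨nofun, fun ho hs => he.openApprox_gfpStar fun a => ?_⟩
    simpa only [Fin.comp_cons] using (ih (Fin.cons a ρ)).2 ho hs

namespace XTerm

variable {n : ℕ} {t : XTerm n}

theorem finite_props (t : XTerm n) : t.props.Finite := by
  induction t with
  | bot | top | nom _ | conom _ | fvar _ => exact Set.finite_empty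
  | prop q => exact Set.finite_singleton q
  | conj _ _ ihs iht | disj _ _ ihs iht | imp _ _ ihs iht | sub _ _ ihs iht => exact ihs.union iht
  | dia _ ih | box _ ih | bbox _ ih | bdia _ ih | mu _ ih | nu _ ih => exact ih

theorem SynClosed.isClosedElem_eval (ht : t.SynClosed) (he : IsCanonicalExtension e)
    (hV : V.IsAdmissible e) (ρ : Fin n → A) : IsClosedElem e (t.eval e V (e ∘ ρ)) := by
  obtain ⟨q, hq⟩ := t.finite_props.exists_notMem
  have h := ((he.approx_eval (s := true) (l := ⊤) (x := fun _ : Unit => ⊤) hV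
    (fun _ => closedApprox_const (map_top e ▸ isClosedElem_map ⊤)) nofun t ρ).1 ht
    (signedProp_of_notMem hq)).1
  rwa [eval_setProp hq] at h

theorem SynOpen.isOpenElem_eval (ht : t.SynOpen) (he : IsCanonicalExtension e)
    (hV : V.IsAdmissible e) (ρ : Fin n → A) : IsOpenElem e (t.eval e V (e ∘ ρ)) := by
  obtain ⟨q, hq⟩ := t.finite_props.exists_notMem
  have h := ((he.approx_eval (s := true) (l := ⊤) (x := fun _ : Unit => ⊤) hV
    (fun _ => closedApprox_const (map_top e ▸ isClosedElem_map ⊤)) nofun t ρ).2 ht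
    (signedProp_of_notMem hq)).1
  rwa [eval_setProp hq] at h

end XTerm

namespace Ineq

theorem holds_substProp {b : Ineq} {α : XTerm 0} :
    (b.lhs.substProp p α ≼ b.rhs.substProp p α).Holds e V ↔
      b.Holds e (V.setProp p (α.eval e V Fin.elim0)) := by
  simp only [Holds, XTerm.eval_substProp]

theorem Holds.anti_prop {b : Ineq} {d : C} (hb : b.Holds e (V.setProp p d))
    (he : IsCanonicalExtension e) (hl : b.lhs.SignedProp s p) (hr : b.rhs.SignedProp (!s) p)
    (hcd : SignedLE s c d) : b.Holds e (V.setProp p c) :=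
  (XTerm.eval_mono_prop he hl hcd _).trans (hb.trans (XTerm.eval_mono_prop he hr
    (signedLE_not.2 hcd) _))

theorem eventually_holds {B : List Ineq} (he : IsCanonicalExtension e) (hV : V.IsAdmissible e)
    (hclosed : s = true → ClosedApprox e l x c) (hopen : s = false → OpenApprox e l x c)
    (hl : ∀ b ∈ B, b.lhs.SignedProp s p ∧ b.lhs.SynClosed)
    (hr : ∀ b ∈ B, b.rhs.SignedProp (!s) p ∧ b.rhs.SynOpen)
    (h : ∀ b ∈ B, b.Holds e (V.setProp p c)) :
    ∀ᶠ i in l, ∀ b ∈ B, b.Holds e (V.setProp p (x i)) := by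
  refine (Filter.eventually_all_finite B.finite_toSet).2 fun b hb => ?_
  have elim0_eq : (Fin.elim0 : Fin 0 → C) = e ∘ Fin.elim0 := Subsingleton.elim _ _
  simp only [Holds, elim0_eq] at h ⊢
  exact he.eventually_le
    ((he.approx_eval hV hclosed hopen b.lhs _).1 (hl b hb).2 (hl b hb).1)
    ((he.approx_eval hV hclosed hopen b.rhs _).2 (hr b hb).2 (hr b hb).1) (h b hb)

end Ineq

variable {αs : List (XTerm 0)} {B : List Ineq}

theorem IsCanonicalExtension.right_ackermann (he : IsCanonicalExtension e)
    (hV : V.IsAdmissible e) (hα : ∀ α ∈ αs, p ∉ α.props ∧ α.SynClosed)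
    (hβ : ∀ b ∈ B, b.lhs.PosIn p ∧ b.lhs.SynClosed)
    (hγ : ∀ b ∈ B, b.rhs.NegIn p ∧ b.rhs.SynOpen) :
    (∃ a, ∀ b ∈ αs.map (· ≼ .prop p) ++ B, b.Holds e (V.setProp p (e a))) ↔
      ∀ b ∈ B.map fun b => b.lhs.substProp p (.bigDisj αs) ≼ b.rhs.substProp p (.bigDisj αs),
        b.Holds e V := by
  set k := (XTerm.bigDisj αs).eval e V Fin.elim0 with hk
  have holds_map (a : A) :
      (∀ α ∈ αs, (α ≼ .prop p).Holds e (V.setProp p (e a))) ↔ k ≤ e a := by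
    rw [hk, XTerm.eval_bigDisj_le]
    refine forall₂_congr fun α hα' => ?_
    simp only [Ineq.Holds, XTerm.eval_setProp (hα α hα').1, XTerm.eval_prop_setProp]
  simp only [List.forall_mem_append, List.forall_mem_map, holds_map, Ineq.holds_substProp, ← hk]
  constructor
  · rintro ⟨a, hka, ha⟩ b hb
    exact (ha b hb).anti_prop (s := true) he (hβ b hb).1 (hγ b hb).1 hka
  · intro h
    have hclosed : IsClosedElem e k := by
      rw [hk, Subsingleton.elim Fin.elim0 (e ∘ Fin.elim0)]
      exact (XTerm.synClosed_bigDisj fun α h => (hα α h).2).isClosedElem_eval he hV _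
    obtain ⟨⟨a, hka⟩, ha⟩ := (Ineq.eventually_holds (s := true) he hV
      (fun _ => closedApprox_atBot hclosed) nofun hβ hγ h).exists
    exact ⟨a, hka, ha⟩

theorem IsCanonicalExtension.left_ackermann (he : IsCanonicalExtension e)
    (hV : V.IsAdmissible e) (hα : ∀ α ∈ αs, p ∉ α.props ∧ α.SynOpen)
    (hβ : ∀ b ∈ B, b.rhs.PosIn p ∧ b.rhs.SynOpen)
    (hγ : ∀ b ∈ B, b.lhs.NegIn p ∧ b.lhs.SynClosed) :
    (∃ a, ∀ b ∈ αs.map (.prop p ≼ ·) ++ B, b.Holds e (V.setProp p (e a))) ↔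
      ∀ b ∈ B.map fun b => b.lhs.substProp p (.bigConj αs) ≼ b.rhs.substProp p (.bigConj αs),
        b.Holds e V := by
  set w := (XTerm.bigConj αs).eval e V Fin.elim0 with hw
  have holds_map (a : A) :
      (∀ α ∈ αs, (.prop p ≼ α).Holds e (V.setProp p (e a))) ↔ e a ≤ w := by
    rw [hw, XTerm.le_eval_bigConj]
    refine forall₂_congr fun α hα' => ?_
    simp only [Ineq.Holds, XTerm.eval_setProp (hα α hα').1, XTerm.eval_prop_setProp]
  simp only [List.forall_mem_append, List.forall_mem_map, holds_map, Ineq.holds_substProp, ← hw]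
  constructor
  · rintro ⟨a, haw, ha⟩ b hb
    exact (ha b hb).anti_prop (s := false) he (hγ b hb).1 (hβ b hb).1 haw
  · intro h
    have hopen : IsOpenElem e w := by
      rw [hw, Subsingleton.elim Fin.elim0 (e ∘ Fin.elim0)]
      exact (XTerm.synOpen_bigConj fun α h => (hα α h).2).isOpenElem_eval he hV _
    obtain ⟨⟨a, haw⟩, ha⟩ := (Ineq.eventually_holds (s := false) he hV nofun
      (fun _ => openApprox_atTop hopen) hγ hβ h).exists
    exact ⟨a, haw, ha⟩

end Ackermann

/-! ### Mu-algebras of the second kind -/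

section Approximants

/-- The transfinite approximants `F^α(⊥)` of the least fixed point of `F`, where joins at limit
ordinals are taken in a poset and are part of the requirement. -/
structure IsApproximantSeq {P : Type u} [PartialOrder P] [OrderBot P] (F : P → P)
    (s : Ordinal.{u} → P) : Prop where
  zero : s 0 = ⊥
  succ : ∀ α, s (Order.succ α) = F (s α)
  limit : ∀ l, Order.IsSuccLimit l → IsLUB (s '' Set.Iio l) (s l)

namespace IsApproximantSeq

variable {P : Type u} [PartialOrder P] [OrderBot P] {F : P → P} {s : Ordinal.{u} → P}
  (hs : IsApproximantSeq F s) (hF : Monotone F)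
include hs hF

theorem le_of_map_le {b : P} (hb : F b ≤ b) (α : Ordinal.{u}) : s α ≤ b := by
  induction α using SuccOrder.limitRecOn with
  | isMin α h =>
    rw [h.eq_bot, Ordinal.bot_eq_zero, hs.zero]
    exact bot_le
  | succ α _ ih =>
    rw [hs.succ]
    exact (hF ih).trans hb
  | isSuccLimit α h ih =>
    exact (isLUB_le_iff (hs.limit α h)).2 (Set.forall_mem_image.2 ih)

theorem le_map (α : Ordinal.{u}) : s α ≤ F (s α) := by
  induction α using SuccOrder.limitRecOn with
  | isMin α h =>
    rw [h.eq_bot, Ordinal.bot_eq_zero, hs.zero]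
    exact bot_le
  | succ α _ ih =>
    rw [hs.succ]
    exact hF ih
  | isSuccLimit α h ih =>
    refine (isLUB_le_iff (hs.limit α h)).2 (Set.forall_mem_image.2 fun β hβ => ?_)
    exact (ih β hβ).trans (hF ((hs.limit α h).1 ⟨β, hβ, rfl⟩))

theorem monotone : Monotone s := fun α β hαβ => by
  induction β using SuccOrder.limitRecOn with
  | isMin β h => rw [h.eq_bot] at hαβ ⊢; rw [le_bot_iff.1 hαβ]
  | succ β _ ih =>
    obtain rfl | hα := hαβ.eq_or_lt
    · exact le_rfl
    · rw [hs.succ]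
      exact (ih (Order.lt_succ_iff.1 hα)).trans (hs.le_map hF β)
  | isSuccLimit β h ih =>
    obtain rfl | hα := hαβ.eq_or_lt
    · exact le_rfl
    · exact (hs.limit β h).1 ⟨α, hα, rfl⟩

theorem exists_map_le : ∃ α, F (s α) ≤ s α := by
  by_contra! h
  have lt_succ (α) : s α < s (Order.succ α) :=
    hs.succ α ▸ (hs.le_map hF α).lt_of_not_ge (h α)
  exact not_injective_of_ordinal s <| StrictMono.injective fun α β hαβ =>
    (lt_succ α).trans_le (hs.monotone hF (Order.succ_le_of_lt hαβ))

theorem isLeast {a : P} (ha : IsLUB (Set.range s) a) : IsLeast {b | F b ≤ b} a := by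
  obtain ⟨α, hα⟩ := hs.exists_map_le hF
  obtain rfl : a = s α := le_antisymm
    ((isLUB_le_iff ha).2 (Set.forall_mem_range.2 (hs.le_of_map_le hF hα))) (ha.1 ⟨α, rfl⟩)
  exact ⟨hα, fun b hb => hs.le_of_map_le hF hb α⟩

end IsApproximantSeq

end Approximants

section SecondKind

variable {A : Type u} [ModalBiheytingAlgebra A] {C : Type v} [CompletelyDistribLattice C]
  {e : BoundedLatticeHom A C} {V : Valuation C}

namespace IsCanonicalExtension

theorem lfpStar_eq_map (he : IsCanonicalExtension e) {g : C → C} {F : A → A} {a : A}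
    (hg : ∀ b, g (e b) = e (F b)) (ha : IsLeast {b | F b ≤ b} a) : lfpStar e g = e a := by
  rw [lfpStar_eq_sInf_image]
  simp only [hg, he.map_le_map]
  exact ((OrderHomClass.mono e).map_isLeast ha).isGLB.sInf_eq

theorem gfpStar_eq_map (he : IsCanonicalExtension e) {g : C → C} {F : A → A} {a : A}
    (hg : ∀ b, g (e b) = e (F b)) (ha : IsGreatest {b | b ≤ F b} a) : gfpStar e g = e a :=
  he.dual.lfpStar_eq_map hg ha

end IsCanonicalExtension

namespace Term

theorem monotone_of_eval_star_cons_eq (he : IsCanonicalExtension e) {n : ℕ} {t : Term (n + 1)}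
    (ht : t.SignedVar true 0) {ρ : Fin n → C} {F : A → A}
    (hF : ∀ b, t.star.eval e V (Fin.cons (e b) ρ) = e (F b)) : Monotone F := fun b c hbc => by
  rw [← he.map_le_map, ← hF, ← hF]
  exact monotone_eval_star_cons he ht ρ (OrderHomClass.mono e hbc)

theorem exists_monotone_eval_star_cons_eq (he : IsCanonicalExtension e) (hA : IsSecondKind A)
    {v : ℕ → A} {n : ℕ} {t : Term (n + 1)} (ht : t.WF) (hpos : t.SignedVar true 0) {ρ : Fin n → A}
    (h : ∀ b c, t.Denotes₂ v (Fin.cons b ρ) c →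
      t.star.eval e V (Fin.cons (e b) (e ∘ ρ)) = e c) :
    ∃ F : A → A, Monotone F ∧ (∀ b, t.star.eval e V (Fin.cons (e b) (e ∘ ρ)) = e (F b)) ∧
      ∀ b c, t.Denotes₂ v (Fin.cons b ρ) c → c = F b := by
  choose F hF using fun b => hA _ t ht v (Fin.cons b ρ)
  have eval_cons (b) := h b (F b) (hF b)
  refine ⟨F, monotone_of_eval_star_cons_eq he hpos eval_cons, eval_cons, fun b c hc => ?_⟩
  exact he.injective ((h b c hc).symm.trans (eval_cons b))

theorem eval_star_of_denotes₂ (he : IsCanonicalExtension e) (hA : IsSecondKind A)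
    {v : ℕ → A} (hV : V.prop = e ∘ v) {n : ℕ} {t : Term n} (ht : t.WF) {ρ : Fin n → A} {a : A}
    (h : t.Denotes₂ v ρ a) : t.star.eval e V (e ∘ ρ) = e a := by
  induction t generalizing a with
  | bot => exact (map_bot e).symm.trans (congrArg e (Eq.symm h))
  | top => exact (map_top e).symm.trans (congrArg e (Eq.symm h))
  | prop p => exact (congrFun hV p).trans (congrArg e (Eq.symm h))
  | fvar x => exact congrArg e (Eq.symm h)
  | conj s t ihs iht =>
    obtain ⟨b, c, hb, hc, rfl⟩ := h
    simp only [star, XTerm.eval, ihs ht.1 hb, iht ht.2 hc, map_inf]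
  | disj s t ihs iht =>
    obtain ⟨b, c, hb, hc, rfl⟩ := h
    simp only [star, XTerm.eval, ihs ht.1 hb, iht ht.2 hc, map_sup]
  | imp s t ihs iht =>
    obtain ⟨b, c, hb, hc, rfl⟩ := h
    simp only [star, XTerm.eval, ihs ht.1 hb, iht ht.2 hc, he.map_himp]
  | sub s t ihs iht =>
    obtain ⟨b, c, hb, hc, rfl⟩ := h
    simp only [star, XTerm.eval, ihs ht.1 hb, iht ht.2 hc, he.map_sdiff]
  | dia t ih =>
    obtain ⟨b, hb, rfl⟩ := h
    simp only [star, XTerm.eval, ih ht hb, he.diaC_map]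
  | box t ih =>
    obtain ⟨b, hb, rfl⟩ := h
    simp only [star, XTerm.eval, ih ht hb, he.boxC_map]
  | mu t ih =>
    obtain ⟨s, zero, succ, limit, ha⟩ := h
    obtain ⟨F, hF, eval_cons, eq_F⟩ := exists_monotone_eval_star_cons_eq (V := V) he hA ht.2 ht.1
      fun b c hc => by simpa only [Fin.comp_cons] using ih ht.2 hc
    exact he.lfpStar_eq_map (g := fun c => t.star.eval e V (Fin.cons c (e ∘ ρ))) eval_cons <|
      IsApproximantSeq.isLeast ⟨zero, fun α => eq_F _ _ (succ α), limit⟩ hF ha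
  | nu t ih =>
    obtain ⟨s, zero, succ, limit, ha⟩ := h
    obtain ⟨F, hF, eval_cons, eq_F⟩ := exists_monotone_eval_star_cons_eq (V := V) he hA ht.2 ht.1
      fun b c hc => by simpa only [Fin.comp_cons] using ih ht.2 hc
    exact he.gfpStar_eq_map (g := fun c => t.star.eval e V (Fin.cons c (e ∘ ρ))) eval_cons <|
      IsApproximantSeq.isLeast (P := Aᵒᵈ) ⟨zero, fun α => eq_F _ _ (succ α), limit⟩ hF.dual ha

theorem eval_star_mem_range (he : IsCanonicalExtension e) (hA : IsSecondKind A)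
    (hV : ∀ p, V.prop p ∈ Set.range e) {n : ℕ} {t : Term n} (ht : t.WF) {ρ : Fin n → C}
    (hρ : ∀ x, ρ x ∈ Set.range e) : t.star.eval e V ρ ∈ Set.range e := by
  choose v hv using hV
  choose r hr using hρ
  obtain rfl : e ∘ r = ρ := funext hr
  obtain ⟨a, ha⟩ := hA n t ht v r
  exact ⟨a, (eval_star_of_denotes₂ he hA (funext fun p => (hv p).symm) ht ha).symm⟩

end Term

end SecondKind

/-! ### Fixed points of join-preserving maps -/

namespace OType

/-- The other entry of an order type: `C^{ε.flip}` is the order dual of `C^ε`. -/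
def flip : OType → OType
  | one => dual
  | dual => one

variable {C : Type v} [CompleteLattice C]

/-- The order of `C^ε`. -/
def le : OType → C → C → Prop
  | one, x, y => x ≤ y
  | dual, x, y => y ≤ x

/-- The least element of `C^ε`. -/
def bot : OType → C
  | one => ⊥
  | dual => ⊤

theorem le_refl (ε : OType) (x : C) : ε.le x x := by
  cases ε <;> exact _root_.le_refl x

theorem bot_le (ε : OType) (x : C) : ε.le ε.bot x := by
  cases ε
  exacts [_root_.bot_le, le_top]

theorem flip_bot (ε : OType) : ε.flip.bot (C := C) = (ε.bot (C := Cᵒᵈ) : C) := by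
  cases ε <;> rfl

theorem flip_le {ε : OType} {x y : C} : ε.flip.le x y ↔ ε.le (C := Cᵒᵈ) x y := by
  cases ε <;> rfl

theorem flip_isIrr {ε : OType} {x : C} : ε.flip.IsIrr x ↔ ε.IsIrr (C := Cᵒᵈ) x := by
  cases ε <;> rfl

end OType

section JoinPreserving

variable {C : Type v} [CompleteLattice C] {n : ℕ} {τ : Fin n → OType}

/-- The element of `C^τ` with coordinate `k` equal to `x` and all other coordinates least. -/
def singleTuple (τ : Fin n → OType) (k : Fin n) (x : C) : Fin n → C :=
  fun l => if l = k then x else (τ l).bot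

theorem singleTuple_flip (k : Fin n) (x : C) :
    singleTuple (fun l => (τ l).flip) k x = (singleTuple (C := Cᵒᵈ) τ k x : Fin n → C) := by
  funext l
  by_cases h : l = k
  · exact (if_pos h).trans (if_pos h).symm
  · exact (if_neg h).trans ((τ l).flip_bot.trans (if_neg h).symm)

theorem singleTuple_le {k : Fin n} {x : C} {ρ : Fin n → C} (hx : (τ k).le x (ρ k)) (l : Fin n) :
    (τ l).le (singleTuple τ k x l) (ρ l) := by
  unfold singleTuple
  split_ifs with h
  · exact h ▸ hx
  · exact (τ l).bot_le (ρ l)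

theorem tauSup_eq {S : Set (Fin n → C)} {ρ : Fin n → C}
    (h_le : ∀ σ ∈ S, ∀ k, (τ k).le (σ k) (ρ k))
    (h_least : ∀ k d, (∀ σ ∈ S, (τ k).le (σ k) d) → (τ k).le (ρ k) d) : tauSup τ S = ρ := by
  funext k
  replace h_le := fun σ hσ => h_le σ hσ k
  specialize h_least k
  unfold tauSup
  cases hk : τ k <;> rw [hk] at h_le h_least
  · exact IsLUB.sSup_eq ⟨Set.forall_mem_image.2 h_le,
      fun d hd => h_least d (Set.forall_mem_image.1 hd)⟩
  · exact IsGLB.sInf_eq ⟨Set.forall_mem_image.2 h_le,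
      fun d hd => h_least d (Set.forall_mem_image.1 hd)⟩

theorem CompletelyMeetPreserving.dual {f : (Fin n → C) → C} (hf : CompletelyMeetPreserving τ f) :
    CompletelyJoinPreserving (C := Cᵒᵈ) τ f := fun S => by
  refine Eq.trans (congrArg f (funext fun k => ?_)) (hf S)
  unfold tauSup tauInf
  cases τ k <;> rfl

theorem CompletelyJoinPreserving.mono {f : (Fin n → C) → C} (hf : CompletelyJoinPreserving τ f)
    {σ ρ : Fin n → C} (h : ∀ k, (τ k).le (σ k) (ρ k)) : f σ ≤ f ρ := by
  have tauSup_pair : tauSup τ {σ, ρ} = ρ :=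
    tauSup_eq (by rintro _ (rfl | rfl); exacts [h, fun k => (τ k).le_refl _])
      fun k d hd => hd ρ (.inr rfl)
  calc f σ ≤ sSup (f '' {σ, ρ}) := le_sSup ⟨σ, .inl rfl, rfl⟩
    _ = f ρ := by rw [← hf, tauSup_pair]

namespace CompletelyJoinPreserving

variable {f : (Fin (n + 1) → C) → C} (hf : CompletelyJoinPreserving (Fin.cons .one τ) f)
include hf

theorem map_cons_bot : f (Fin.cons ⊥ fun k => (τ k).bot) = ⊥ := by
  have tauSup_empty : tauSup (Fin.cons .one τ) ∅ =
      (Fin.cons ⊥ fun k => (τ k).bot : Fin (n + 1) → C) :=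
    tauSup_eq (fun _ h => h.elim) <| Fin.cases (fun _ _ => bot_le) fun k d _ => (τ k).bot_le d
  rw [← tauSup_empty, hf, Set.image_empty, sSup_empty]

theorem map_cons_sup (x y : C) (σ : Fin n → C) :
    f (Fin.cons (x ⊔ y) σ) = f (Fin.cons x σ) ⊔ f (Fin.cons y fun k => (τ k).bot) := by
  have tauSup_pair : tauSup (Fin.cons .one τ) {Fin.cons x σ, Fin.cons y fun k => (τ k).bot} =
      Fin.cons (x ⊔ y) σ := by
    refine tauSup_eq ?_ ?_
    · rintro _ (rfl | rfl)
      · exact Fin.cases le_sup_left fun k => (τ k).le_refl (σ k)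
      · exact Fin.cases le_sup_right fun k => (τ k).bot_le (σ k)
    · exact Fin.cases (fun d hd => sup_le (hd (Fin.cons x σ) (.inl rfl)) (hd _ (.inr rfl)))
        fun k d hd => hd (Fin.cons x σ) (.inl rfl)
  rw [← tauSup_pair, hf, Set.image_pair, sSup_pair]

theorem map_cons_eq_sup (x : C) (σ : Fin n → C) :
    f (Fin.cons x σ) = f (Fin.cons ⊥ σ) ⊔ f (Fin.cons x fun k => (τ k).bot) := by
  rw [← hf.map_cons_sup, bot_sup_eq]

theorem map_cons_singleTuple_le (x : C) {k : Fin n} {y : C} {ρ : Fin n → C}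
    (hy : (τ k).le y (ρ k)) : f (Fin.cons x (singleTuple τ k y)) ≤ f (Fin.cons x ρ) :=
  hf.mono <| Fin.cases le_rfl (singleTuple_le hy)

end CompletelyJoinPreserving

theorem CompletelyMeetPreserving.le_map_cons_singleTuple {f : (Fin (n + 1) → C) → C}
    (hf : CompletelyMeetPreserving (Fin.cons .one τ) f) (x : C) {k : Fin n} {y : C}
    {ρ : Fin n → C} (hy : (τ k).flip.le y (ρ k)) :
    f (Fin.cons x ρ) ≤ f (Fin.cons x (singleTuple (fun l => (τ l).flip) k y)) := by
  rw [singleTuple_flip]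
  exact hf.dual.map_cons_singleTuple_le x (OType.flip_le.1 hy)

end JoinPreserving

section FixedPointApproximation

variable {A : Type u} [ModalBiheytingAlgebra A] {C : Type v} [CompletelyDistribLattice C]
  {e : BoundedLatticeHom A C}

theorem IsCJI.not_le_bot {j : C} (hj : IsCJI j) : ¬ j ≤ ⊥ := fun h => by
  obtain ⟨_, hx, -⟩ := hj.exists_le (h.trans_eq sSup_empty.symm)
  exact hx

theorem IsCJI.le_or_le {j x y : C} (hj : IsCJI j) (h : j ≤ x ⊔ y) : j ≤ x ∨ j ≤ y := by
  obtain ⟨_, rfl | rfl, hz⟩ := hj.exists_le (h.trans_eq sSup_pair.symm)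
  exacts [.inl hz, .inr hz]

namespace IsCanonicalExtension

theorem otype_le_of_forall_isIrr (he : IsCanonicalExtension e) {ε : OType} {c d : C}
    (h : ∀ x, ε.IsIrr x → ε.le x c → ε.le x d) : ε.le c d := by
  cases ε
  exacts [he.le_of_forall_isCJI h, he.le_of_forall_isCMI h]

variable {n : ℕ} {τ : Fin n → OType} {f : (Fin (n + 1) → C) → C}

theorem map_cons_bot_le (he : IsCanonicalExtension e)
    (hf : CompletelyJoinPreserving (Fin.cons .one τ) f) {ρ : Fin n → C} {c : C}
    (h : ∀ k x, (τ k).IsIrr x → (τ k).le x (ρ k) → f (Fin.cons ⊥ (singleTuple τ k x)) ≤ c) :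
    f (Fin.cons ⊥ ρ) ≤ c := by
  let T : Set (Fin (n + 1) → C) :=
    {σ | ∃ k x, (τ k).IsIrr x ∧ (τ k).le x (ρ k) ∧ σ = Fin.cons ⊥ (singleTuple τ k x)}
  have tauSup_T : tauSup (Fin.cons .one τ) T = Fin.cons ⊥ ρ := by
    refine tauSup_eq ?_ (Fin.cases (fun _ _ => bot_le) fun k d hd => ?_)
    · rintro _ ⟨k, x, -, hx, rfl⟩
      exact Fin.cases bot_le (singleTuple_le hx)
    · refine he.otype_le_of_forall_isIrr fun x hx hxk => ?_
      simpa only [Fin.cons_succ, singleTuple, if_true] using hd _ ⟨k, x, hx, hxk, rfl⟩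
  rw [← tauSup_T, hf]
  refine sSup_le ?_
  rintro _ ⟨_, ⟨k, x, hx, hxk, rfl⟩, rfl⟩
  exact h k x hx hxk

theorem exists_isIrr_le_lfpStar (he : IsCanonicalExtension e)
    (hf : CompletelyJoinPreserving (Fin.cons .one τ) f) {ρ : Fin n → C}
    (hρ : IsClosedElem e (f (Fin.cons ⊥ ρ))) {j : C} (hj : IsCJI j)
    (h : j ≤ lfpStar e fun c => f (Fin.cons c ρ)) :
    ∃ k x, (τ k).IsIrr x ∧ (τ k).le x (ρ k) ∧
      j ≤ lfpStar e fun c => f (Fin.cons c (singleTuple τ k x)) := by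
  by_contra! not_le
  let B : Set A := {b | f (Fin.cons (e b) fun k => (τ k).bot) ≤ e b ∧ ¬ j ≤ e b}
  have directed_B : Directed (· ≤ ·) ((↑) : B → A) := fun b c =>
    ⟨⟨b ⊔ c, by
      rw [Set.mem_ofPred, map_sup, hf.map_cons_sup]
      exact ⟨sup_le_sup b.2.1 c.2.1, fun hj_le => (hj.le_or_le hj_le).elim b.2.2 c.2.2⟩⟩,
      le_sup_left, le_sup_right⟩
  have nonempty_B : Nonempty B := ⟨⊥, by
    rw [Set.mem_ofPred, map_bot, hf.map_cons_bot]
    exact ⟨le_rfl, hj.not_le_bot⟩⟩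
  have map_le_iSup : f (Fin.cons ⊥ ρ) ≤ ⨆ b : B, e b := by
    refine he.map_cons_bot_le hf fun k x hx hxk => ?_
    have hj_not_le := not_le k x hx hxk
    simp only [lfpStar_eq_sInf_image, le_sInf_iff, Set.forall_mem_image, not_forall] at hj_not_le
    obtain ⟨b, hb, hjb⟩ := hj_not_le
    rw [Set.mem_ofPred, hf.map_cons_eq_sup, sup_le_iff] at hb
    exact hb.1.trans (le_iSup (fun b : B => e b) ⟨b, hb.2, hjb⟩)
  obtain ⟨b, hb⟩ := he.exists_le_map directed_B hρ map_le_iSup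
  refine b.2.2 (h.trans (lfpStar_le ?_))
  rw [hf.map_cons_eq_sup]
  exact sup_le hb b.2.1

theorem exists_isIrr_gfpStar_le (he : IsCanonicalExtension e)
    (hf : CompletelyMeetPreserving (Fin.cons .one τ) f) {ρ : Fin n → C}
    (hρ : IsOpenElem e (f (Fin.cons ⊤ ρ))) {m : C} (hm : IsCMI m)
    (h : gfpStar e (fun c => f (Fin.cons c ρ)) ≤ m) :
    ∃ k x, (τ k).flip.IsIrr x ∧ (τ k).flip.le x (ρ k) ∧
      gfpStar e (fun c => f (Fin.cons c (singleTuple (fun l => (τ l).flip) k x))) ≤ m := by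
  obtain ⟨k, (x : C), hx, hxk, hle⟩ := he.dual.exists_isIrr_le_lfpStar hf.dual hρ hm h
  exact ⟨k, x, OType.flip_isIrr.2 hx, OType.flip_le.2 hxk, by rwa [singleTuple_flip]⟩

end IsCanonicalExtension

end FixedPointApproximation

/-! ### Soundness of the rules -/

/-- The nominals of an inequality for `ε = 1`, its co-nominals for `ε = ∂`. -/
def Ineq.names (x : Ineq) (ε : OType) : Set ℕ := x.lhs.names ε ∪ x.rhs.names ε

theorem nomFresh_iff {q : QIneq} {ε : OType} {y : ℕ} :
    nomFresh q ε y ↔ ∀ x ∈ q.con :: q.ants, y ∉ x.names ε := by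
  cases ε <;> exact not_exists.trans (forall_congr' fun x => not_and)

section FlippedNotation

variable {q : QIneq} {ε : OType} {y : ℕ} {n : ℕ} {τ : Fin n → OType} {k : Fin n} {s t : XTerm 0}

theorem conomFresh_eq_flip : conomFresh q ε y = nomFresh q ε.flip y := by
  cases ε <;> rfl

theorem conomT_eq_flip : conomT ε y = nomT ε.flip y := by
  cases ε <;> rfl

theorem topT_eq_flip : topT ε = botT ε.flip := by
  cases ε <;> rfl

theorem leT_eq_flip : leT ε s t = leT ε.flip t s := by
  cases ε <;> rfl

theorem conomTuple_eq_flip : conomTuple τ k y = nomTuple (fun l => (τ l).flip) k y := by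
  funext l
  simp only [conomTuple, nomTuple, conomT_eq_flip, topT_eq_flip]

end FlippedNotation

section Soundness

variable {A : Type u} [ModalBiheytingAlgebra A] {C : Type v} [CompletelyDistribLattice C]
  {e : BoundedLatticeHom A C} {V : Valuation C}

theorem Ineq.holds_setProp {x : Ineq} {p : ℕ} (hp : p ∉ x.props) (c : C) :
    x.Holds e (V.setProp p c) ↔ x.Holds e V := by
  rw [Ineq.props, Set.mem_union, not_or] at hp
  rw [Holds, XTerm.eval_setProp hp.1, XTerm.eval_setProp hp.2, Holds]

theorem Ineq.holds_setName {x : Ineq} {ε : OType} {y : ℕ} (hy : y ∉ x.names ε) (c : C) :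
    x.Holds e (V.setName ε y c) ↔ x.Holds e V := by
  rw [Ineq.names, Set.mem_union, not_or] at hy
  rw [Holds, XTerm.eval_setName hy.1, XTerm.eval_setName hy.2, Holds]

theorem Ineq.holds_leT {ε : OType} {s t : XTerm 0} :
    (leT ε s t).Holds e V ↔ ε.le (s.eval e V Fin.elim0) (t.eval e V Fin.elim0) := by
  cases ε <;> rfl

theorem XTerm.eval_setName_of_nomFresh {x : Ineq} {Γ : List Ineq} {c : Ineq} {ε : OType} {y : ℕ}
    (hy : nomFresh ⟨x :: Γ, c⟩ ε y) {t : XTerm 0} (ht : t.names ε ⊆ x.names ε) (z : C) :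
    t.eval e (V.setName ε y z) Fin.elim0 = t.eval e V Fin.elim0 :=
  eval_setName (fun h => nomFresh_iff.1 hy x (List.mem_cons_of_mem c List.mem_cons_self) (ht h)) _ _

theorem XTerm.eval_setName_setName_of_notMem {x : Ineq} {Γ : List Ineq} {c : Ineq} {j n : ℕ}
    (hj : j ∉ QIneq.noms ⟨x :: Γ, c⟩) (hn : n ∉ QIneq.conoms ⟨x :: Γ, c⟩) {t : XTerm 0}
    (ht : ∀ ε, t.names ε ⊆ x.names ε) (z w : C) :
    t.eval e ((V.setName .one j z).setName .dual n w) Fin.elim0 = t.eval e V Fin.elim0 := by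
  rw [eval_setName_of_nomFresh (ε := .dual) hn (ht .dual),
    eval_setName_of_nomFresh (ε := .one) hj (ht .one)]

theorem XTerm.eval_nomT_setName (ε : OType) (y : ℕ) (c : C) (ρ : Fin 0 → C) :
    (nomT ε y).eval e (V.setName ε y c) ρ = c := by
  cases ε <;> exact Function.update_self ..

theorem XTerm.eval_botT (ε : OType) (ρ : Fin 0 → C) : (botT ε).eval e V ρ = ε.bot := by
  cases ε <;> rfl

theorem XTerm.eval_nomTuple {n : ℕ} (τ : Fin n → OType) (k : Fin n) (y : ℕ) (ρ : Fin 0 → C) :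
    (fun l => (nomTuple τ k y l).eval e V ρ) =
      singleTuple τ k ((nomT (τ k) y).eval e V ρ) := by
  funext l
  simp only [nomTuple, singleTuple, apply_ite (XTerm.eval e V · ρ), eval_botT]

namespace QIneq

variable {Γ : List Ineq} {c : Ineq}

theorem admValid_cons_congr {x y : Ineq}
    (h : ∀ V : Valuation C, x.Holds e V ↔ y.Holds e V) :
    AdmValid e ⟨x :: Γ, c⟩ ↔ AdmValid e ⟨y :: Γ, c⟩ := by
  simp only [AdmValid, List.forall_mem_cons, h]

theorem admValid_cons_cons_congr {x y z : Ineq}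
    (h : ∀ V : Valuation C, x.Holds e V ↔ y.Holds e V ∧ z.Holds e V) :
    AdmValid e ⟨x :: Γ, c⟩ ↔ AdmValid e ⟨y :: z :: Γ, c⟩ := by
  simp only [AdmValid, List.forall_mem_cons, h, and_assoc]

theorem admValid_iff_forall {ι : Type*} {Δ : List Ineq} {Δ' : ι → List Ineq}
    (of : ∀ k (V : Valuation C), V.IsAdmissible e → (∀ x ∈ Δ' k, x.Holds e V) →
      ∀ x ∈ Δ, x.Holds e V)
    (change : ∀ V : Valuation C, V.IsAdmissible e → (∀ x ∈ Δ, x.Holds e V) →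
      ∃ k, ∃ W : Valuation C, W.IsAdmissible e ∧ (∀ x ∈ Δ' k, x.Holds e W) ∧
        ∀ x ∈ c :: Γ, (x.Holds e W ↔ x.Holds e V)) :
    AdmValid e ⟨Δ ++ Γ, c⟩ ↔ ∀ k, AdmValid e ⟨Δ' k ++ Γ, c⟩ := by
  simp only [AdmValid, List.forall_mem_append]
  refine ⟨fun h k V hV hx => h V hV ⟨of k V hV hx.1, hx.2⟩, fun h V hV hx => ?_⟩
  obtain ⟨k, W, hW, hΔ', hWV⟩ := change V hV hx.1
  rw [List.forall_mem_cons] at hWV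
  exact hWV.1.1 (h k W hW ⟨hΔ', fun x hxΓ => (hWV.2 x hxΓ).2 (hx.2 x hxΓ)⟩)

theorem admValid_iff_of_setProp {p : ℕ} {Δ Δ' : List Ineq}
    (hp : ∀ x ∈ c :: Γ, p ∉ x.props)
    (h : ∀ V : Valuation C, V.IsAdmissible e →
      ((∃ a, ∀ x ∈ Δ, x.Holds e (V.setProp p (e a))) ↔ ∀ x ∈ Δ', x.Holds e V)) :
    AdmValid e ⟨Δ ++ Γ, c⟩ ↔ AdmValid e ⟨Δ' ++ Γ, c⟩ := by
  rw [← forall_const Unit (b := AdmValid e ⟨Δ ++ Γ, c⟩)]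
  refine (admValid_iff_forall (fun _ V hV hx => ?_) fun V hV hx => ?_).symm
  · obtain ⟨a, ha⟩ := hV.prop p
    have setProp_self : V.setProp p (e a) = V := by
      rw [Valuation.setProp, ha, Function.update_eq_self]
    exact (h V hV).1 ⟨a, by rwa [setProp_self]⟩
  · obtain ⟨a, ha⟩ := (h V hV).2 hx
    exact ⟨(), V.setProp p (e a), hV.setProp p a, ha,
      fun x hxc => Ineq.holds_setProp (hp x hxc) (e a)⟩

theorem admValid_iff_forall_name {ι : Type*} {ε : ι → OType} {y : ι → ℕ} {x : Ineq}
    {x' : ι → Ineq} {s : ι → XTerm 0}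
    (hy : ∀ k, nomFresh ⟨x :: Γ, c⟩ (ε k) (y k)) (hs : ∀ k, (s k).names (ε k) ⊆ x.names (ε k))
    (of : ∀ k (V : Valuation C), (x' k).Holds e V →
      (leT (ε k) (nomT (ε k) (y k)) (s k)).Holds e V → x.Holds e V)
    (approx : ∀ V : Valuation C, V.IsAdmissible e → x.Holds e V →
      ∃ k z, (ε k).IsIrr z ∧ (ε k).le z ((s k).eval e V Fin.elim0) ∧
        (x' k).Holds e (V.setName (ε k) (y k) z)) :
    AdmValid e ⟨x :: Γ, c⟩ ↔
      ∀ k, AdmValid e ⟨x' k :: leT (ε k) (nomT (ε k) (y k)) (s k) :: Γ, c⟩ := by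
  refine admValid_iff_forall (Δ := [x]) (Δ' := fun k => [x' k, _]) (fun k V _ => ?_)
    fun V hV hx => ?_
  · simpa only [List.forall_mem_cons, List.not_mem_nil, false_imp_iff, implies_true, and_true,
      and_imp] using of k V
  · obtain ⟨k, z, hz, hzs, hx'⟩ := approx V hV (hx x List.mem_cons_self)
    have fresh := nomFresh_iff.1 (hy k)
    refine ⟨k, V.setName (ε k) (y k) z, hV.setName (y k) hz, ?_, fun b hb =>
      Ineq.holds_setName (fresh b (List.cons_subset_cons c (List.subset_cons_self x Γ) hb)) z⟩
    simp only [List.forall_mem_cons, List.not_mem_nil, false_imp_iff, implies_true, and_true,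
      Ineq.holds_leT, XTerm.eval_nomT_setName, XTerm.eval_setName_of_nomFresh (hy k) (hs k)]
    exact ⟨hx', hzs⟩

theorem admValid_iff_of_name {ε : OType} {y : ℕ} {x x' : Ineq} {s : XTerm 0}
    (hy : nomFresh ⟨x :: Γ, c⟩ ε y) (hs : s.names ε ⊆ x.names ε)
    (of : ∀ V : Valuation C, x'.Holds e V → (leT ε (nomT ε y) s).Holds e V → x.Holds e V)
    (approx : ∀ V : Valuation C, V.IsAdmissible e → x.Holds e V →
      ∃ z, ε.IsIrr z ∧ ε.le z (s.eval e V Fin.elim0) ∧ x'.Holds e (V.setName ε y z)) :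
    AdmValid e ⟨x :: Γ, c⟩ ↔ AdmValid e ⟨x' :: leT ε (nomT ε y) s :: Γ, c⟩ :=
  (admValid_iff_forall_name (ι := Unit) (fun _ => hy) (fun _ => hs) (fun _ => of)
    fun V hV hx => ⟨(), approx V hV hx⟩).trans (forall_const Unit)

theorem admValid_iff_of_nom_conom {j n : ℕ} {x x' : Ineq} {s t : XTerm 0}
    (hj : j ∉ noms ⟨x :: Γ, c⟩) (hn : n ∉ conoms ⟨x :: Γ, c⟩)
    (hs : ∀ ε, s.names ε ⊆ x.names ε) (ht : ∀ ε, t.names ε ⊆ x.names ε)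
    (of : ∀ V : Valuation C, x'.Holds e V → (.nom j ≼ s).Holds e V → (t ≼ .conom n).Holds e V →
      x.Holds e V)
    (approx : ∀ V : Valuation C, V.IsAdmissible e → x.Holds e V →
      ∃ z w, IsCJI z ∧ IsCMI w ∧ z ≤ s.eval e V Fin.elim0 ∧ t.eval e V Fin.elim0 ≤ w ∧
        x'.Holds e ((V.setName .one j z).setName .dual n w)) :
    AdmValid e ⟨x :: Γ, c⟩ ↔ AdmValid e ⟨x' :: (.nom j ≼ s) :: (t ≼ .conom n) :: Γ, c⟩ := by
  rw [← forall_const Unit (b := AdmValid e ⟨x' :: _, c⟩)]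
  refine admValid_iff_forall (Δ := [x]) (Δ' := fun _ => [x', _, _]) (fun _ V _ => ?_)
    fun V hV hx => ?_
  · simpa only [List.forall_mem_cons, List.not_mem_nil, false_imp_iff, implies_true, and_true,
      and_imp] using of V
  · obtain ⟨z, w, hz, hw, hzs, htw, hx'⟩ := approx V hV (hx x List.mem_cons_self)
    have fresh_j := nomFresh_iff (ε := .one).1 hj
    have fresh_n := nomFresh_iff (ε := .dual).1 hn
    refine ⟨(), (V.setName .one j z).setName .dual n w,
      (hV.setName (ε := .one) j hz).setName (ε := .dual) n hw, ?_, fun b hb => ?_⟩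
    · simp only [List.forall_mem_cons, List.not_mem_nil, false_imp_iff, implies_true, and_true,
        Ineq.Holds, XTerm.eval_setName_setName_of_notMem hj hn hs,
        XTerm.eval_setName_setName_of_notMem hj hn ht]
      exact ⟨hx', (Function.update_self j z V.nom).trans_le hzs,
        htw.trans_eq (Function.update_self n w V.conom).symm⟩
    · have hb' := List.cons_subset_cons c (List.subset_cons_self x Γ) hb
      rw [Ineq.holds_setName (fresh_n b hb'), Ineq.holds_setName (fresh_j b hb')]

end QIneq

namespace IsCanonicalExtension

theorem exists_isCJI_le_diaC (he : IsCanonicalExtension e) {j c : C} (hj : IsCJI j)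
    (h : j ≤ diaC e c) : ∃ i, IsCJI i ∧ i ≤ c ∧ j ≤ diaC e i := by
  rw [he.eq_sSup_isCJI c, he.diaC_sSup] at h
  obtain ⟨_, ⟨i, ⟨hi, hic⟩, rfl⟩, h'⟩ := hj.exists_le h
  exact ⟨i, hi, hic, h'⟩

theorem exists_isCMI_boxC_le (he : IsCanonicalExtension e) {m c : C} (hm : IsCMI m)
    (h : boxC e c ≤ m) : ∃ n, IsCMI n ∧ c ≤ n ∧ boxC e n ≤ m := by
  simp only [boxC_eq_diaC_dual] at h ⊢
  exact exists_isCJI_le_diaC (A := Aᵒᵈ) (C := Cᵒᵈ) he.dual hm h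

theorem exists_isCJI_isCMI_himp_le (he : IsCanonicalExtension e) {m c d : C} (hm : IsCMI m)
    (h : c ⇨ d ≤ m) : ∃ j n, IsCJI j ∧ IsCMI n ∧ j ≤ c ∧ d ≤ n ∧ j ⇨ n ≤ m := by
  rw [he.eq_sSup_isCJI c, sSup_eq_iSup', iSup_himp_eq] at h
  obtain ⟨_, ⟨⟨j, hj, hjc⟩, rfl⟩, hjm : j ⇨ d ≤ m⟩ := hm.exists_le h
  rw [he.eq_sInf_isCMI d, sInf_eq_iInf', himp_iInf_eq] at hjm
  obtain ⟨_, ⟨⟨n, hn, hdn⟩, rfl⟩, hjnm⟩ := hm.exists_le hjm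
  exact ⟨j, n, hj, hn, hjc, hdn, hjnm⟩

theorem exists_isCJI_isCMI_le_sdiff (he : IsCanonicalExtension e) {i c d : C} (hi : IsCJI i)
    (h : i ≤ c \ d) : ∃ j n, IsCJI j ∧ IsCMI n ∧ j ≤ c ∧ d ≤ n ∧ i ≤ j \ n := by
  obtain ⟨n, j, hn, hj, hdn, hjc, hij⟩ :=
    exists_isCJI_isCMI_himp_le (A := Aᵒᵈ) (C := Cᵒᵈ) he.dual hi h
  exact ⟨j, n, hj, hn, hjc, hdn, hij⟩

end IsCanonicalExtension

namespace QIneq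

variable {Γ : List Ineq} {c : Ineq}

theorem admValid_boxAppr (he : IsCanonicalExtension e) {ψ : XTerm 0} {m n : ℕ}
    (hn : n ∉ conoms ⟨(.box ψ ≼ .conom m) :: Γ, c⟩) :
    AdmValid e ⟨(.box ψ ≼ .conom m) :: Γ, c⟩ ↔
      AdmValid e ⟨(.box (.conom n) ≼ .conom m) :: (ψ ≼ .conom n) :: Γ, c⟩ := by
  refine admValid_iff_of_name (ε := .dual) hn Set.subset_union_left
    (fun V hnm hψn => (he.boxC_mono hψn).trans hnm) fun V hV hψm => ?_
  obtain ⟨z, hz, hψz, hzm⟩ := he.exists_isCMI_boxC_le (hV.conom m) hψm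
  refine ⟨z, hz, hψz, ?_⟩
  rw [Ineq.Holds, XTerm.eval_setName_of_nomFresh (ε := .dual) hn Set.subset_union_right]
  exact (congrArg (boxC e) (XTerm.eval_nomT_setName .dual n z _)).trans_le hzm

theorem admValid_diaAppr (he : IsCanonicalExtension e) {ψ : XTerm 0} {j i : ℕ}
    (hi : i ∉ noms ⟨(.nom j ≼ .dia ψ) :: Γ, c⟩) :
    AdmValid e ⟨(.nom j ≼ .dia ψ) :: Γ, c⟩ ↔
      AdmValid e ⟨(.nom j ≼ .dia (.nom i)) :: (.nom i ≼ ψ) :: Γ, c⟩ := by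
  refine admValid_iff_of_name (ε := .one) hi Set.subset_union_right
    (fun V hji hiψ => hji.trans (he.diaC_mono hiψ)) fun V hV hjψ => ?_
  obtain ⟨z, hz, hzψ, hjz⟩ := he.exists_isCJI_le_diaC (hV.nom j) hjψ
  refine ⟨z, hz, hzψ, ?_⟩
  rw [Ineq.Holds, XTerm.eval_setName_of_nomFresh (ε := .one) hi Set.subset_union_left]
  exact hjz.trans_eq (congrArg (diaC e) (XTerm.eval_nomT_setName .one i z _)).symm

theorem admValid_impAppr (he : IsCanonicalExtension e) {χ φ : XTerm 0} {m j n : ℕ}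
    (hj : j ∉ noms ⟨(.imp χ φ ≼ .conom m) :: Γ, c⟩)
    (hn : n ∉ conoms ⟨(.imp χ φ ≼ .conom m) :: Γ, c⟩) :
    AdmValid e ⟨(.imp χ φ ≼ .conom m) :: Γ, c⟩ ↔
      AdmValid e
        ⟨(.imp (.nom j) (.conom n) ≼ .conom m) :: (.nom j ≼ χ) :: (φ ≼ .conom n) :: Γ, c⟩ := by
  refine admValid_iff_of_nom_conom hj hn
    (fun | .one | .dual => Set.subset_union_left.trans Set.subset_union_left)
    (fun | .one | .dual => Set.subset_union_right.trans Set.subset_union_left)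
    (fun V hjnm hjχ hφn => (himp_le_himp hjχ hφn).trans hjnm) fun V hV hm => ?_
  obtain ⟨z, w, hz, hw, hzχ, hφw, hzwm⟩ := he.exists_isCJI_isCMI_himp_le (hV.conom m) hm
  refine ⟨z, w, hz, hw, hzχ, hφw, ?_⟩
  rw [Ineq.Holds, XTerm.eval_setName_setName_of_notMem hj hn
    fun | .one | .dual => Set.subset_union_right]
  exact (congrArg₂ (· ⇨ ·) (Function.update_self j z V.nom)
    (Function.update_self n w V.conom)).trans_le hzwm

theorem admValid_subAppr (he : IsCanonicalExtension e) {χ φ : XTerm 0} {i j n : ℕ}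
    (hj : j ∉ noms ⟨(.nom i ≼ .sub χ φ) :: Γ, c⟩)
    (hn : n ∉ conoms ⟨(.nom i ≼ .sub χ φ) :: Γ, c⟩) :
    AdmValid e ⟨(.nom i ≼ .sub χ φ) :: Γ, c⟩ ↔
      AdmValid e
        ⟨(.nom i ≼ .sub (.nom j) (.conom n)) :: (.nom j ≼ χ) :: (φ ≼ .conom n) :: Γ, c⟩ := by
  refine admValid_iff_of_nom_conom hj hn
    (fun | .one | .dual => Set.subset_union_left.trans Set.subset_union_right)
    (fun | .one | .dual => Set.subset_union_right.trans Set.subset_union_right)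
    (fun V hijn hjχ hφn => hijn.trans (sdiff_le_sdiff hjχ hφn)) fun V hV hi => ?_
  obtain ⟨z, w, hz, hw, hzχ, hφw, hizw⟩ := he.exists_isCJI_isCMI_le_sdiff (hV.nom i) hi
  refine ⟨z, w, hz, hw, hzχ, hφw, ?_⟩
  rw [Ineq.Holds, XTerm.eval_setName_setName_of_notMem hj hn
    fun | .one | .dual => Set.subset_union_left]
  exact hizw.trans_eq (congrArg₂ (· \ ·) (Function.update_self j z V.nom)
    (Function.update_self n w V.conom)).symm

variable {n : ℕ} {τ : Fin n → OType} {y : Fin n → ℕ}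

theorem admValid_muApprox (he : IsCanonicalExtension e) (hA : IsSecondKind A)
    {ψ : Term (n + 1)} {φ : Fin n → Term 0} {i : ℕ} (hψ : ψ.WF) (hφ : ∀ k, (φ k).WF)
    (hpres : ∀ V : Valuation C, CompletelyJoinPreserving (Fin.cons .one τ) (ψ.star.eval e V))
    (hfresh : ∀ k, nomFresh ⟨(.nom i ≼ ψ.mu.star.subst fun l => (φ l).star) :: Γ, c⟩ (τ k) (y k)) :
    AdmValid e ⟨(.nom i ≼ ψ.mu.star.subst fun l => (φ l).star) :: Γ, c⟩ ↔
      ∀ k, AdmValid e ⟨(.nom i ≼ ψ.mu.star.subst (nomTuple τ k (y k))) ::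
        leT (τ k) (nomT (τ k) (y k)) (φ k).star :: Γ, c⟩ := by
  refine admValid_iff_forall_name hfresh (fun k => by simp only [Term.names_star, Set.empty_subset])
    (fun k V hi hk => ?_) fun V hV hi => ?_
  · rw [Ineq.holds_leT] at hk
    rw [Ineq.Holds, Term.star, XTerm.eval_subst, XTerm.eval_mu] at hi ⊢
    rw [XTerm.eval_nomTuple] at hi
    exact hi.trans (lfpStar_mono fun a => (hpres V).map_cons_singleTuple_le (e a) hk)
  · rw [Ineq.Holds, Term.star, XTerm.eval_subst, XTerm.eval_mu] at hi
    have isClosedElem_bot :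
        IsClosedElem e (ψ.star.eval e V (Fin.cons ⊥ fun l => (φ l).star.eval e V Fin.elim0)) := by
      obtain ⟨a, ha⟩ := Term.eval_star_mem_range he hA hV.prop hψ
        (ρ := Fin.cons ⊥ fun l => (φ l).star.eval e V Fin.elim0) (Fin.cases ⟨⊥, map_bot e⟩ fun l =>
          Term.eval_star_mem_range he hA hV.prop (hφ l) (ρ := Fin.elim0) nofun)
      exact ha ▸ isClosedElem_map a
    obtain ⟨k, z, hz, hzk, hiz⟩ :=
      he.exists_isIrr_le_lfpStar (hpres V) isClosedElem_bot (hV.nom i) hi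
    refine ⟨k, z, hz, hzk, ?_⟩
    rw [Ineq.Holds, XTerm.eval_setName_of_nomFresh (hfresh k) Set.subset_union_left,
      XTerm.eval_subst, XTerm.eval_nomTuple, XTerm.eval_nomT_setName, Term.star, XTerm.eval_mu]
    simp only [Term.eval_star_setName]
    exact hiz

theorem admValid_nuApprox (he : IsCanonicalExtension e) (hA : IsSecondKind A)
    {φ : Term (n + 1)} {ψ : Fin n → Term 0} {m : ℕ} (hφ : φ.WF) (hψ : ∀ k, (ψ k).WF)
    (hpres : ∀ V : Valuation C, CompletelyMeetPreserving (Fin.cons .one τ) (φ.star.eval e V))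
    (hfresh : ∀ k, conomFresh
      ⟨(φ.nu.star.subst (fun l => (ψ l).star) ≼ .conom m) :: Γ, c⟩ (τ k) (y k)) :
    AdmValid e ⟨(φ.nu.star.subst (fun l => (ψ l).star) ≼ .conom m) :: Γ, c⟩ ↔
      ∀ k, AdmValid e ⟨(φ.nu.star.subst (conomTuple τ k (y k)) ≼ .conom m) ::
        leT (τ k) (ψ k).star (conomT (τ k) (y k)) :: Γ, c⟩ := by
  simp only [conomFresh_eq_flip] at hfresh
  simp only [conomTuple_eq_flip, conomT_eq_flip, leT_eq_flip (s := (ψ _).star)]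
  refine admValid_iff_forall_name hfresh (fun k => by simp only [Term.names_star, Set.empty_subset])
    (fun k V hm hk => ?_) fun V hV hm => ?_
  · rw [Ineq.holds_leT] at hk
    rw [Ineq.Holds, Term.star, XTerm.eval_subst, XTerm.eval_nu] at hm ⊢
    rw [XTerm.eval_nomTuple] at hm
    exact (gfpStar_mono fun a => (hpres V).le_map_cons_singleTuple (e a) hk).trans hm
  · rw [Ineq.Holds, Term.star, XTerm.eval_subst, XTerm.eval_nu] at hm
    have isOpenElem_top :
        IsOpenElem e (φ.star.eval e V (Fin.cons ⊤ fun l => (ψ l).star.eval e V Fin.elim0)) := by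
      obtain ⟨a, ha⟩ := Term.eval_star_mem_range he hA hV.prop hφ
        (ρ := Fin.cons ⊤ fun l => (ψ l).star.eval e V Fin.elim0) (Fin.cases ⟨⊤, map_top e⟩ fun l =>
          Term.eval_star_mem_range he hA hV.prop (hψ l) (ρ := Fin.elim0) nofun)
      exact ha ▸ isOpenElem_map a
    obtain ⟨k, z, hz, hzk, hzm⟩ :=
      he.exists_isIrr_gfpStar_le (hpres V) isOpenElem_top (hV.conom m) hm
    refine ⟨k, z, hz, hzk, ?_⟩
    rw [Ineq.Holds, XTerm.eval_setName_of_nomFresh (hfresh k) Set.subset_union_right,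
      XTerm.eval_subst, XTerm.eval_nomTuple, XTerm.eval_nomT_setName, Term.star, XTerm.eval_nu]
    simp only [Term.eval_star_setName]
    exact hzm

end QIneq

theorem OrdStep.admValid_iff (he : IsCanonicalExtension e) {q q' : QIneq} (h : OrdStep q q') :
    q.AdmValid e ↔ q'.AdmValid e := by
  cases h with
  | rearrange h => simp only [QIneq.AdmValid, h]
  | subLR => exact QIneq.admValid_cons_congr fun _ => sdiff_le_iff
  | impRR => exact QIneq.admValid_cons_congr fun _ => le_himp_iff
  | conjLR => exact QIneq.admValid_cons_congr fun _ => le_himp_iff.symm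
  | conjLR' => exact QIneq.admValid_cons_congr fun _ => le_himp_iff'.symm
  | disjRR => exact QIneq.admValid_cons_congr fun _ => sdiff_le_iff.symm
  | disjRR' => exact QIneq.admValid_cons_congr fun _ => sdiff_le_iff'.symm
  | disjLA => exact QIneq.admValid_cons_cons_congr fun _ => sup_le_iff
  | conjRA => exact QIneq.admValid_cons_cons_congr fun _ => le_inf_iff
  | diaLA => exact QIneq.admValid_cons_congr fun _ => he.gc_diaC_bboxC _ _
  | boxRA => exact QIneq.admValid_cons_congr fun _ => (he.gc_bdiaC_boxC _ _).symm
  | boxAppr ψ m n Γ c hn => exact QIneq.admValid_boxAppr he hn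
  | diaAppr ψ j i Γ c hi => exact QIneq.admValid_diaAppr he hi
  | impAppr χ φ m j n Γ c hj hn => exact QIneq.admValid_impAppr he hj hn
  | subAppr χ φ i j n Γ c hj hn => exact QIneq.admValid_subAppr he hj hn
  | rightAckermann p αs B Γ c hα hβ hγ hΓ hc =>
    exact QIneq.admValid_iff_of_setProp (List.forall_mem_cons.2 ⟨hc, hΓ⟩) fun V hV =>
      he.right_ackermann hV hα hβ hγ
  | leftAckermann p αs B Γ c hα hβ hγ hΓ hc =>
    exact QIneq.admValid_iff_of_setProp (List.forall_mem_cons.2 ⟨hc, hΓ⟩) fun V hV =>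
      he.left_ackermann hV hα hβ hγ

theorem Step.admValid_iff (he : IsCanonicalExtension e) (hA : IsSecondKind A) {q : QIneq}
    {S : Set QIneq} (h : Step e q S) : q.AdmValid e ↔ ∀ q' ∈ S, q'.AdmValid e := by
  cases h with
  | ord h => simp only [h.admValid_iff he, Set.mem_singleton_iff, forall_eq]
  | muApprox τ ψ φ i y Γ c hψ hφ _ hpres hfresh =>
    rw [Set.forall_mem_range]
    exact QIneq.admValid_muApprox he hA hψ.2 hφ hpres hfresh
  | nuApprox τ φ ψ m y Γ c hφ hψ _ hpres hfresh =>
    rw [Set.forall_mem_range]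
    exact QIneq.admValid_nuApprox he hA hφ.2 hψ hpres hfresh

theorem SetStep.admValid_iff (he : IsCanonicalExtension e) (hA : IsSecondKind A)
    {Q Q' : Set QIneq} (h : SetStep e Q Q') :
    (∀ q ∈ Q, q.AdmValid e) ↔ ∀ q ∈ Q', q.AdmValid e := by
  obtain ⟨q, hq, S, hS, rfl⟩ := h
  have hQ : Q = Q \ {q} ∪ {q} := (Set.sdiff_union_of_subset (Set.singleton_subset_iff.2 hq)).symm
  conv_lhs => rw [hQ]
  simp only [Set.mem_union, or_imp, forall_and, Set.mem_singleton_iff, forall_eq,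
    hS.admValid_iff he hA]

theorem admValid_firstApprox (he : IsCanonicalExtension e) (φ ψ : Term 0) (i m : ℕ) :
    (φ.star ≼ ψ.star).AdmValid e ↔ (firstApprox φ ψ i m).AdmValid e := by
  refine ⟨fun h V hV hants => ?_, fun h V hV => ?_⟩
  · obtain ⟨hiφ, hψm, -⟩ := by simpa only [firstApprox, List.forall_mem_cons] using hants
    exact (hiφ.trans (h V hV)).trans hψm
  · refine he.le_of_forall_isCJI fun j hj hjφ => he.le_of_forall_isCMI fun n hn hψn => ?_
    have hjn := h _ ((hV.setName (ε := .one) i hj).setName (ε := .dual) m hn)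
    simp only [firstApprox, List.forall_mem_cons, List.not_mem_nil, false_imp_iff, implies_true,
      and_true, Ineq.Holds, Term.eval_star_setName] at hjn
    simp only [XTerm.eval, Valuation.setName, Function.update_self, and_imp] at hjn
    exact hjn hjφ hψn

end Soundness

end MuALBA

theorem mainTheorem4_general {A : Type u} [MuALBA.ModalBiheytingAlgebra A]
    {C : Type v} [CompletelyDistribLattice C]
    (e : BoundedLatticeHom A C) (he : MuALBA.IsCanonicalExtension e)
    (φ ψ : MuALBA.Term 0) (i m : ℕ) :
    (MuALBA.IsSecondKind A →
      ∀ Q : Set MuALBA.QIneq, MuALBA.Derives e {MuALBA.firstApprox φ ψ i m} Q →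
        (MuALBA.Ineq.AdmValid e (MuALBA.Ineq.mk φ.star ψ.star) ↔
          ∀ q ∈ Q, MuALBA.QIneq.AdmValid e q)) ∧
    (∀ q : MuALBA.QIneq,
      Relation.ReflTransGen MuALBA.OrdStep (MuALBA.firstApprox φ ψ i m) q →
      (MuALBA.Ineq.AdmValid e (MuALBA.Ineq.mk φ.star ψ.star) ↔
        MuALBA.QIneq.AdmValid e q)) := by
  rw [MuALBA.admValid_firstApprox he φ ψ i m]
  refine ⟨fun hA Q hQ => ?_, fun q hq => ?_⟩
  · induction hQ with
    | refl => simp only [Set.mem_singleton_iff, forall_eq]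
    | tail _ h ih => exact ih.trans (h.admValid_iff he hA)
  · induction hq with
    | refl => rfl
    | tail _ h ih => exact ih.trans (h.admValid_iff he)

theorem mainTheorem4 {A : Type u} [MuALBA.ModalBiheytingAlgebra A]
    {C : Type v} [CompletelyDistribLattice C]
    (e : BoundedLatticeHom A C) (he : MuALBA.IsCanonicalExtension e)
    (φ ψ : MuALBA.Term 0) (hφ : φ.WF) (hψ : ψ.WF) (i m : ℕ) :
    (MuALBA.IsSecondKind A →
      ∀ Q : Set MuALBA.QIneq, MuALBA.Derives e {MuALBA.firstApprox φ ψ i m} Q →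
        (MuALBA.Ineq.AdmValid e (MuALBA.Ineq.mk φ.star ψ.star) ↔
          ∀ q ∈ Q, MuALBA.QIneq.AdmValid e q)) ∧
    (MuALBA.IsFirstKind A →
      ∀ q : MuALBA.QIneq,
        Relation.ReflTransGen MuALBA.OrdStep (MuALBA.firstApprox φ ψ i m) q →
        (MuALBA.Ineq.AdmValid e (MuALBA.Ineq.mk φ.star ψ.star) ↔
          MuALBA.QIneq.AdmValid e q)) :=
  have h := mainTheorem4_general e he φ ψ i m
  ⟨h.1, fun _ => h.2⟩
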